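/- \textbf{Theorem (radial limits).} Let $d\ge 2$ and let $\lambda:\mathbb R^d\to(0,\infty)$ be measurable with $1/\lambda$ locally integrable. For $\alpha\in\{0,1\}^d$ let $\Delta_\alpha=\{\sum_{i=1}^d(-1)^{\alpha_i}t_ie_i:\ t_1,\dots,t_d>0\}$ be the open octants of $\mathbb R^d$, and assume that there are numbers $\lambda_\alpha>0$ with $$\lim_{\|x\|\to\infty,\ x\in\Delta_\alpha}\lambda(x)=\lambda_\alpha\qquad\text{for every }\alpha\in\{0,1\}^d .$$ Assume moreover: if $d=2$, there is some $\gamma\in(0,1/2)$ such that $\int_{\|x\|\le R}\lambda(x)^{-1}\|x\|^{-2\gamma}\,dx<\infty$ for every $R>0$; if $d>2$, then $\int_{\|x\|\le R}\lambda(x)^{-1}\|x\|^{2-d}\,dx<\infty$ for every $R>0$. (No global upper or lower bound on $\lambda$ is assumed.) Let $B$ and $W$ be $d$-dimensional Wiener processes started at $0$ (possibly on different probability spaces), and put $$S_B(t)=\int_0^t\frac{ds}{\lambda(B_s)},\qquad \tau_t=\inf\{u>0:\ S_B(u)>t\},\qquad \nu(t)=\int_0^t\upsilon(W_s)\,ds,\qquad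 \upsilon=\sum_{\alpha\in\{0,1\}^d}\frac1{\lambda_\alpha}\mathbf 1_{\Delta_\alpha}.$$ Then almost surely $S_B$ and $\nu$ are finite, continuous and strictly increasing, vanish at $0$ and tend to $\infty$; in particular $\tau_t<\infty$ for all $t$, the inverse $\nu^{-1}:[0,\infty)\to[0,\infty)$ exists, and the processes $t\mapsto B_{\tau_{nt}}$ ($n\ge1$) and $t\mapsto W(\nu^{-1}(t))$ have continuous paths. For every $T\geq 0$, $$\Big\{\frac{B_{\tau_{nt}}}{\sqrt n},\ t\in[0,T]\Big\}\ \Longrightarrow\ \big\{W(\nu^{-1}(t)),\ t\in[0,T]\big\}\qquad(n\to\infty),$$ in the sense of weak convergence of probability laws on $C([0,T],\mathbb R^d)$ with the uniform topology. (The limit process $W(\nu^{-1}(\cdot))$ is called a multidimensional skew Brownian motion.) -/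

import Mathlib

open MeasureTheory ProbabilityTheory Filter Topology
open scoped NNReal ENNReal

/-- A `d`-dimensional Wiener process started at `0`: the coordinates are independent
real Brownian motions (with almost surely continuous paths). -/
structure IsWienerProcess {d : ℕ} {Ω : Type*} [MeasurableSpace Ω]
    (B : ℝ≥0 → Ω → EuclideanSpace ℝ (Fin d)) (P : Measure Ω) : Prop where
  coord : ∀ i : Fin d, IsBrownianReal (fun t ω => B t ω i) P
  indep : iIndepFun (fun (i : Fin d) (ω : Ω) (t : ℝ≥0) => B t ω i) P

/-- The open octant `Δ_α = {∑ (-1)^{α_i} t_i e_i : t_1, …, t_d > 0}`. -/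
def octant {d : ℕ} (α : Fin d → Fin 2) : Set (EuclideanSpace ℝ (Fin d)) :=
  {x | ∃ t : Fin d → ℝ, (∀ i, 0 < t i) ∧ ∀ i, x i = (-1) ^ (α i : ℕ) * t i}

/-- The additive functional `t ↦ ∫_0^t f(w_s) ds` of a path `w`, with values in `[0, ∞]`. -/
noncomputable def additiveFunctional {E : Type*} (f : E → ℝ≥0∞) (w : ℝ≥0 → E) (t : ℝ≥0) : ℝ≥0∞ :=
  ∫⁻ s in Set.Icc (0 : ℝ) t, f (w s.toNNReal)

/-- The generalized right-continuous inverse `t ↦ inf {u > 0 : A(u) > t}`, with `inf ∅ = ∞`. -/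
noncomputable def rightInverse (A : ℝ≥0 → ℝ≥0∞) (t : ℝ≥0) : ℝ≥0∞ :=
  ⨅ (u : ℝ≥0) (_ : 0 < u ∧ (t : ℝ≥0∞) < A u), (u : ℝ≥0∞)

/-- `A` is a continuous strictly increasing bijection of `[0, ∞)` onto `[0, ∞)`; its generalized
right-continuous inverse is then its inverse function, and is finite. -/
structure IsClock (A : ℝ≥0 → ℝ≥0∞) : Prop where
  zero : A 0 = 0
  finite : ∀ t, A t < ∞
  continuous : Continuous A
  strictMono : StrictMono A
  tendsto_top : Tendsto A atTop (𝓝 ∞)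

/-- The path `w` run with the inverse of the clock `A`, i.e. `t ↦ w(A⁻¹(t))`. -/
noncomputable def timeChange {E : Type*} (w : ℝ≥0 → E) (A : ℝ≥0 → ℝ≥0∞) (t : ℝ≥0) : E :=
  w (rightInverse A t).toNNReal

/-- `S_w(t) = ∫_0^t ds / lam(w_s)`. -/
noncomputable def intensityClock {E : Type*} (lam : E → ℝ) (w : ℝ≥0 → E) : ℝ≥0 → ℝ≥0∞ :=
  additiveFunctional (fun x => (ENNReal.ofReal (lam x))⁻¹) w

/-- `υ = ∑_α lamInf_α⁻¹ 1_{Δ_α}`. -/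
noncomputable def octantDensity {d : ℕ} (lamInf : (Fin d → Fin 2) → ℝ)
    (x : EuclideanSpace ℝ (Fin d)) : ℝ :=
  ∑ α : Fin d → Fin 2, (lamInf α)⁻¹ * (octant α).indicator (fun _ => (1 : ℝ)) x

/-- `ν(t) = ∫_0^t υ(w_s) ds`. -/
noncomputable def octantClock {d : ℕ} (lamInf : (Fin d → Fin 2) → ℝ)
    (w : ℝ≥0 → EuclideanSpace ℝ (Fin d)) : ℝ≥0 → ℝ≥0∞ :=
  additiveFunctional (fun x => ENNReal.ofReal (octantDensity lamInf x)) w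

/-- The path `t ↦ w(ν⁻¹(t))`. If `w` is the path of a Wiener process, this is the path of a
multidimensional skew Brownian motion. -/
noncomputable def skewPath {d : ℕ} (lamInf : (Fin d → Fin 2) → ℝ)
    (w : ℝ≥0 → EuclideanSpace ℝ (Fin d)) : ℝ≥0 → EuclideanSpace ℝ (Fin d) :=
  timeChange w (octantClock lamInf w)

/-- The path `t ↦ w(τ_{n t}) / √n`, where `τ` is the generalized inverse of `∫_0^· ds / lam(w_s)`. -/
noncomputable def scaledPath {d : ℕ} (lam : EuclideanSpace ℝ (Fin d) → ℝ) (n : ℕ)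
    (w : ℝ≥0 → EuclideanSpace ℝ (Fin d)) (t : ℝ≥0) : EuclideanSpace ℝ (Fin d) :=
  (Real.sqrt n)⁻¹ • timeChange w (intensityClock lam w) (n * t)

/-- Spaces of continuous maps (with the compact-open topology, which on `C([0, T], ℝ^d)` is the
topology of uniform convergence) carry their Borel σ-algebra. -/
instance instMeasurableSpaceContinuousMap {X Y : Type*} [TopologicalSpace X] [TopologicalSpace Y] :
    MeasurableSpace C(X, Y) := borel C(X, Y)

instance instBorelSpaceContinuousMap {X Y : Type*} [TopologicalSpace X] [TopologicalSpace Y] :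
    BorelSpace C(X, Y) := ⟨rfl⟩

open Classical in
/-- The restriction of a path to `[0, T]` as an element of `C([0, T], E)`
(the zero function if the restriction is not continuous). -/
noncomputable def restrictPath {E : Type*} [TopologicalSpace E] [Zero E] (T : ℝ≥0)
    (w : ℝ≥0 → E) : C(Set.Icc (0 : ℝ≥0) T, E) :=
  if h : Continuous (fun t : Set.Icc (0 : ℝ≥0) T => w t) then ⟨fun t => w t, h⟩ else 0

/-!
The proof compares clocks. Write `S(t) = ∫_0^t ds / λ(w_s)` and `ν(t) = ∫_0^t υ(w_s) ds`. By
Brownian scaling, `t ↦ B(τ_{nt}) / √n` is the path `w(s) = B(ns) / √n`, again a Wiener process, run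
with the inverse of `A_n(t) = ∫_0^t ds / λ(√n w_s)` (`scaledPath_eq_timeChange`). Since the law of
`w` does not depend on `n`, it suffices to prove that `w ∘ A_n⁻¹ → w ∘ ν⁻¹` in probability along the
paths of one Wiener measure (`IsWienerProcess.law_unique`, `IsWienerProcess.map_brownianScaling`).

As `υ` is invariant under dilations, `|A_n - ν|` is bounded on `[0, M]` by
`D_n = ∫_0^M g(√n w_s) ds` with `g = |1/λ - υ|`, a function which vanishes at infinity outside the
null set of coordinate hyperplanes. The expectation of `D_n` is, by scaling, the time average
`(1/n) E ∫_0^{nM} g(w_s) ds`. Far away `g` is small; on a ball the expected occupation density of the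
Wiener process up to time `t` is at most `C t^γ ‖x‖^{-2γ}` in the plane
(`lintegral_heatKernel_two`) and `C ‖x‖^{2-d}` for `d > 2` (`lintegral_heatKernel_of_two_lt`), and
these are the weights against which `1/λ` is assumed integrable. Hence `E D_n → 0`
(`IsWienerProcess.tendsto_lintegral_additiveFunctional_div`). Along a subsequence of any sequence the
clocks therefore converge uniformly almost surely, and as `ν` has speed bounded below, so do their
inverses and the time-changed paths (`tendsto_restrictPath_timeChange`).

The same estimate yields the path properties of `S`: it is finite because `S ≤ ν + ∫ g(w_s) ds`, and
unbounded because `S ≥ ν - ∫ g(w_s) ds`, where `ν` grows linearly and the error has sublinear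
expectation (`ae_exists_le_of_tendsto_lintegral_div`).
-/

/-! ### Wiener measure on path space -/

/-- The space of continuous paths `[0, ∞) → ℝ^d`, with the σ-algebra generated by the
evaluations (as a subtype of a product). -/
abbrev PathSpace (d : ℕ) := {w : ℝ≥0 → EuclideanSpace ℝ (Fin d) // Continuous w}

/-- The coordinate process on path space. -/
def canonicalProcess (d : ℕ) (t : ℝ≥0) (w : PathSpace d) : EuclideanSpace ℝ (Fin d) := w.1 t

lemma measurable_canonicalProcess {d : ℕ} (t : ℝ≥0) : Measurable (canonicalProcess d t) :=
  (measurable_pi_apply t).comp measurable_subtype_coe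

lemma measurable_uncurry_path {d : ℕ} :
    Measurable (fun p : PathSpace d × ℝ≥0 => p.1.1 p.2) :=
  (measurable_uncurry_of_continuous_of_measurable (u := canonicalProcess d)
    (fun w => w.2) measurable_canonicalProcess).comp measurable_swap

lemma IsWienerProcess.aemeasurable {d : ℕ} {Ω : Type*} [MeasurableSpace Ω]
    {B : ℝ≥0 → Ω → EuclideanSpace ℝ (Fin d)} {P : Measure Ω} (hB : IsWienerProcess B P) (t : ℝ≥0) :
    AEMeasurable (B t) P := by
  have h : AEMeasurable (fun ω => WithLp.toLp 2 (fun i => B t ω i)) P :=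
    (WithLp.measurable_toLp 2 _).comp_aemeasurable
      (aemeasurable_pi_lambda _ fun i => (hB.coord i).toIsPreBrownianReal.aemeasurable t)
  exact h

lemma IsWienerProcess.ae_continuous {d : ℕ} {Ω : Type*} [MeasurableSpace Ω]
    {B : ℝ≥0 → Ω → EuclideanSpace ℝ (Fin d)} {P : Measure Ω} (hB : IsWienerProcess B P) :
    ∀ᵐ ω ∂P, Continuous (B · ω) := by
  have h : ∀ᵐ ω ∂P, ∀ i, Continuous (fun t => B t ω i) := ae_all_iff.2 fun i => (hB.coord i).cont
  filter_upwards [h] with ω hω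
  have : Continuous fun t => WithLp.toLp 2 (fun i => B t ω i) :=
    (PiLp.continuous_toLp 2 _).comp (continuous_pi hω)
  exact this

/-- Being a Wiener process only depends on the process up to indistinguishability. -/
lemma IsWienerProcess.congr {d : ℕ} {Ω : Type*} [MeasurableSpace Ω]
    {B C : ℝ≥0 → Ω → EuclideanSpace ℝ (Fin d)} {P : Measure Ω} (hB : IsWienerProcess B P)
    (h : ∀ᵐ ω ∂P, ∀ t, B t ω = C t ω) : IsWienerProcess C P where
  coord i :=
    { toIsPreBrownianReal := (hB.coord i).toIsPreBrownianReal.congr fun t => by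
        filter_upwards [h] with ω hω
        rw [hω t]
      cont := by
        filter_upwards [h, (hB.coord i).cont] with ω hω hc
        simpa only [hω] using hc }
  indep := hB.indep.congr fun i => by
    filter_upwards [h] with ω hω
    funext t
    rw [hω t]

/-- A Wiener process is indistinguishable from a random element of path space. -/
lemma IsWienerProcess.exists_measurable_path {d : ℕ} {Ω : Type*} [MeasurableSpace Ω]
    {B : ℝ≥0 → Ω → EuclideanSpace ℝ (Fin d)} {P : Measure Ω} (hB : IsWienerProcess B P) :
    ∃ b : Ω → PathSpace d, Measurable b ∧ ∀ᵐ ω ∂P, ∀ t, B t ω = (b ω).1 t := by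
  classical
  obtain ⟨D, hDc, hDd⟩ := TopologicalSpace.exists_countable_dense ℝ≥0
  have hgood : ∀ᵐ ω ∂P, Continuous (B · ω) ∧ ∀ q ∈ D, B q ω = (hB.aemeasurable q).mk _ ω := by
    filter_upwards [hB.ae_continuous,
      (ae_ball_iff hDc).2 fun q _ => (hB.aemeasurable q).ae_eq_mk] with ω h1 h2
    exact ⟨h1, h2⟩
  set N := toMeasurable P {ω | ¬ (Continuous (B · ω) ∧ ∀ q ∈ D, B q ω = (hB.aemeasurable q).mk _ ω)}
    with hN
  have hN0 : P N = 0 := by rw [hN, measure_toMeasurable]; exact hgood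
  have hNm : MeasurableSet N := measurableSet_toMeasurable _ _
  have hNc : ∀ ω, ω ∉ N → Continuous (B · ω) ∧ ∀ q ∈ D, B q ω = (hB.aemeasurable q).mk _ ω := by
    intro ω hω
    by_contra hcon
    exact hω (subset_toMeasurable P _ hcon)
  have hcont : ∀ ω, Continuous (fun t => if ω ∈ N then 0 else B t ω) := by
    intro ω
    by_cases h : ω ∈ N
    · simp only [h, if_true]; exact continuous_const
    · simp only [h, if_false]; exact (hNc ω h).1
  refine ⟨fun ω => ⟨fun t => if ω ∈ N then 0 else B t ω, hcont ω⟩, ?_, ?_⟩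
  · refine Measurable.subtype_mk (measurable_pi_lambda _ fun t => ?_)
    have hDq : ∀ q ∈ D, Measurable fun ω => if ω ∈ N then 0 else B q ω := by
      intro q hq
      have : (fun ω => if ω ∈ N then 0 else B q ω) =
          fun ω => if ω ∈ N then 0 else (hB.aemeasurable q).mk _ ω := by
        funext ω
        split_ifs with h
        · rfl
        · exact (hNc ω h).2 q hq
      rw [this]
      exact Measurable.ite hNm measurable_const (hB.aemeasurable q).measurable_mk
    obtain ⟨u, huD, hu⟩ := mem_closure_iff_seq_limit.1 (hDd t)
    refine measurable_of_tendsto_metrizable (fun n => hDq (u n) (huD n)) ?_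
    rw [tendsto_pi_nhds]
    exact fun ω => ((hcont ω).tendsto t).comp hu
  · have : ∀ᵐ ω ∂P, ω ∉ N := measure_eq_zero_iff_ae_notMem.1 hN0
    filter_upwards [this] with ω hω t
    simp [hω]

/-- The property of being a Wiener process is a property of the law on path space. -/
lemma IsWienerProcess.map_path {d : ℕ} {Ω : Type*} [MeasurableSpace Ω]
    {P : Measure Ω} [IsProbabilityMeasure P] {b : Ω → PathSpace d} (hb : Measurable b)
    (hB : IsWienerProcess (fun t ω => (b ω).1 t) P) :
    IsWienerProcess (canonicalProcess d) (P.map b) where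
  coord i :=
    { hasLaw := fun I => by
        have h := (hB.coord i).hasLaw I
        have hm : Measurable fun w : PathSpace d => I.restrict (fun t => canonicalProcess d t w i) :=
          measurable_pi_lambda _ fun t =>
            (EuclideanSpace.proj (𝕜 := ℝ) i).measurable.comp (measurable_canonicalProcess _)
        refine ⟨hm.aemeasurable, ?_⟩
        rw [Measure.map_map hm hb]
        exact h.map_eq
      cont := ae_of_all _ fun w => (EuclideanSpace.proj (𝕜 := ℝ) i).continuous.comp w.2 }
  indep := by
    have hm : ∀ i, Measurable fun (w : PathSpace d) (t : ℝ≥0) => canonicalProcess d t w i :=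
      fun i => measurable_pi_lambda _ fun t =>
        (EuclideanSpace.proj (𝕜 := ℝ) i).measurable.comp (measurable_canonicalProcess t)
    have := Measure.isProbabilityMeasure_map (μ := P) hb.aemeasurable
    have h := (iIndepFun_iff_map_fun_eq_pi_map
      (f := fun i ω (t : ℝ≥0) => canonicalProcess d t (b ω) i)
      (fun i => ((hm i).comp hb).aemeasurable)).1 hB.indep
    rw [iIndepFun_iff_map_fun_eq_pi_map (fun i => (hm i).aemeasurable),
      Measure.map_map (measurable_pi_lambda _ hm) hb]
    refine h.trans ?_
    congr 1
    funext i
    rw [Measure.map_map (hm i) hb]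
    rfl

/-- There is at most one Wiener measure on path space: independence fixes the law given those of
the coordinates, and these are fixed by their finite-dimensional marginals. -/
lemma IsWienerProcess.law_unique {d : ℕ} {μ ν : Measure (PathSpace d)} [IsProbabilityMeasure μ]
    [IsProbabilityMeasure ν] (hμ : IsWienerProcess (canonicalProcess d) μ)
    (hν : IsWienerProcess (canonicalProcess d) ν) : μ = ν := by
  have hm : ∀ i, Measurable fun (w : PathSpace d) (t : ℝ≥0) => canonicalProcess d t w i :=
    fun i => measurable_pi_lambda _ fun t =>
      (EuclideanSpace.proj (𝕜 := ℝ) i).measurable.comp (measurable_canonicalProcess t)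
  have key : ∀ {ρ : Measure (PathSpace d)} [IsProbabilityMeasure ρ],
      IsWienerProcess (canonicalProcess d) ρ → ∀ i,
      IsProjectiveLimit (ρ.map fun (w : PathSpace d) (t : ℝ≥0) => canonicalProcess d t w i)
        BrownianReal.projectiveFamily := by
    intro ρ _ hρ i I
    rw [Measure.map_map (Finset.measurable_restrict I) (hm i)]
    exact ((hρ.coord i).hasLaw I).map_eq
  have hcoord : ∀ i, μ.map (fun (w : PathSpace d) (t : ℝ≥0) => canonicalProcess d t w i) =
      ν.map (fun (w : PathSpace d) (t : ℝ≥0) => canonicalProcess d t w i) :=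
    fun i => (key hμ i).unique (key hν i)
  have h1 := (iIndepFun_iff_map_fun_eq_pi_map (fun i => (hm i).aemeasurable)).1 hμ.indep
  have h2 := (iIndepFun_iff_map_fun_eq_pi_map (fun i => (hm i).aemeasurable)).1 hν.indep
  simp_rw [hcoord] at h1
  have h3 := h1.trans h2.symm
  -- The σ-algebra of path space is the one pulled back along the coordinates.
  ext s hs
  obtain ⟨s', hs', rfl⟩ := hs
  let e : (Fin d → ℝ≥0 → ℝ) → ℝ≥0 → EuclideanSpace ℝ (Fin d) :=
    fun x t => WithLp.toLp 2 fun i => x i t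
  have he : Measurable e := measurable_pi_lambda _ fun t =>
    (WithLp.measurable_toLp 2 _).comp (measurable_pi_lambda _ fun i =>
      (measurable_pi_apply t).comp (measurable_pi_apply i))
  have h4 := congrArg (fun ρ => ρ (e ⁻¹' s')) h3
  simp only at h4
  rw [Measure.map_apply (measurable_pi_lambda _ hm) (he hs'),
    Measure.map_apply (measurable_pi_lambda _ hm) (he hs')] at h4
  exact h4

/-- Brownian scaling of a path: `s ↦ c^{-1/2} w(c s)`. -/
noncomputable def brownianScaling {d : ℕ} (c : ℝ≥0) (w : PathSpace d) : PathSpace d :=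
  ⟨fun t => (√(c : ℝ))⁻¹ • w.1 (c * t),
    (w.2.comp (continuous_const.mul continuous_id : Continuous fun t => c * t)).const_smul
      (√(c : ℝ))⁻¹⟩

lemma measurable_brownianScaling {d : ℕ} (c : ℝ≥0) :
    Measurable (brownianScaling (d := d) c) :=
  Measurable.subtype_mk (measurable_pi_lambda _ fun t =>
    (measurable_canonicalProcess (c * t)).const_smul (√(c : ℝ))⁻¹)

/-- Brownian scaling preserves Wiener measure. -/
lemma IsWienerProcess.map_brownianScaling {d : ℕ} {μ : Measure (PathSpace d)}
    [IsProbabilityMeasure μ] (hμ : IsWienerProcess (canonicalProcess d) μ) {c : ℝ≥0} (hc : c ≠ 0) :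
    μ.map (brownianScaling c) = μ := by
  have := Measure.isProbabilityMeasure_map (μ := μ)
    (measurable_brownianScaling (d := d) c).aemeasurable
  have happ : ∀ i : Fin d, (fun (t : ℝ≥0) (w : PathSpace d) => (brownianScaling c w).1 t i) =
      fun t w => (√(c : ℝ))⁻¹ * canonicalProcess d (c * t) w i := fun i => rfl
  refine law_unique (map_path (measurable_brownianScaling c) ⟨fun i => ?_, ?_⟩) hμ
  · rw [happ i]
    exact (hμ.coord i).smul hc
  · refine hμ.indep.comp (fun _ x t => (√(c : ℝ))⁻¹ * x (c * t)) fun i => ?_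
    exact measurable_pi_lambda _ fun t => (measurable_pi_apply (c * t)).const_mul _

/-! ### Heat kernel and potential estimates -/

/-- The density at time `s` of a `d`-dimensional Wiener process started at `0`. -/
noncomputable def heatKernel (d : ℕ) (s : ℝ) (x : EuclideanSpace ℝ (Fin d)) : ℝ :=
  (√(2 * Real.pi * s))⁻¹ ^ d * Real.exp (-‖x‖ ^ 2 / (2 * s))

lemma measurable_heatKernel {d : ℕ} :
    Measurable (fun p : ℝ × EuclideanSpace ℝ (Fin d) => heatKernel d p.1 p.2) := by
  unfold heatKernel
  fun_prop

lemma pi_gaussianReal_eq_withDensity {d : ℕ} {s : ℝ≥0} (hs : s ≠ 0) :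
    Measure.pi (fun _ : Fin d => gaussianReal 0 s) =
      volume.withDensity (fun x => ENNReal.ofReal (∏ i, gaussianPDFReal 0 s (x i))) := by
  refine Measure.pi_eq fun A hA => ?_
  have hint : ∀ i, Integrable ((A i).indicator (gaussianPDFReal 0 s)) :=
    fun i => (integrable_gaussianPDFReal 0 s).indicator (hA i)
  have hnn : ∀ i x, 0 ≤ (A i).indicator (gaussianPDFReal 0 s) x :=
    fun i x => Set.indicator_nonneg (fun y _ => gaussianPDFReal_nonneg 0 s y) x
  rw [withDensity_apply _ (MeasurableSet.univ_pi hA), ← lintegral_indicator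
    (MeasurableSet.univ_pi hA)]
  have h1 : ∀ x : Fin d → ℝ, (Set.univ.pi A).indicator
      (fun x => ENNReal.ofReal (∏ i, gaussianPDFReal 0 s (x i))) x =
      ENNReal.ofReal (∏ i, (A i).indicator (gaussianPDFReal 0 s) (x i)) := by
    intro x
    by_cases hx : x ∈ Set.univ.pi A
    · rw [Set.indicator_of_mem hx]
      congr 1
      exact Finset.prod_congr rfl fun i _ => (Set.indicator_of_mem (hx i trivial) _).symm
    · rw [Set.indicator_of_notMem hx]
      simp only [Set.mem_pi, Set.mem_univ, true_implies, not_forall] at hx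
      obtain ⟨i, hi⟩ := hx
      rw [Finset.prod_eq_zero (Finset.mem_univ i) (Set.indicator_of_notMem hi _)]
      simp
  simp_rw [h1]
  rw [← ofReal_integral_eq_lintegral_ofReal]
  · rw [integral_fintype_prod_volume_eq_prod, ENNReal.ofReal_prod_of_nonneg
      fun i _ => integral_nonneg (hnn i)]
    refine Finset.prod_congr rfl fun i _ => ?_
    rw [integral_indicator (hA i), gaussianReal_apply_eq_integral 0 hs]
  · exact Integrable.fintype_prod (f := fun i => (A i).indicator (gaussianPDFReal 0 s)) hint
  · exact ae_of_all _ fun x => Finset.prod_nonneg fun i _ => hnn i _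

lemma IsWienerProcess.map_eval {d : ℕ} {μ : Measure (PathSpace d)} [IsProbabilityMeasure μ]
    (hμ : IsWienerProcess (canonicalProcess d) μ) {s : ℝ≥0} (hs : s ≠ 0) :
    μ.map (canonicalProcess d s) =
      volume.withDensity (fun x => ENNReal.ofReal (heatKernel d s x)) := by
  have hm : ∀ i, Measurable fun w : PathSpace d => canonicalProcess d s w i :=
    fun i => (EuclideanSpace.proj (𝕜 := ℝ) i).measurable.comp (measurable_canonicalProcess s)
  have hind : iIndepFun (fun (i : Fin d) (w : PathSpace d) => canonicalProcess d s w i) μ :=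
    hμ.indep.comp (fun _ x => x s) fun i => measurable_pi_apply s
  have h1 : μ.map (fun w i => canonicalProcess d s w i) =
      Measure.pi (fun _ : Fin d => gaussianReal 0 s) := by
    rw [(iIndepFun_iff_map_fun_eq_pi_map fun i => (hm i).aemeasurable).1 hind]
    congr 1
    funext i
    exact ((hμ.coord i).toIsPreBrownianReal.hasLaw_eval s).map_eq
  rw [pi_gaussianReal_eq_withDensity hs] at h1
  have h2 : canonicalProcess d s = (WithLp.toLp 2) ∘
      (fun (w : PathSpace d) (i : Fin d) => canonicalProcess d s w i) := rfl
  rw [h2, ← Measure.map_map (WithLp.measurable_toLp 2 _) (measurable_pi_lambda _ hm), h1]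
  have hdens : ∀ x : EuclideanSpace ℝ (Fin d), (∏ i, gaussianPDFReal 0 s (x i)) =
      heatKernel d s x := by
    intro x
    simp only [gaussianPDFReal, heatKernel, sub_zero]
    rw [Finset.prod_mul_distrib, ← Real.exp_sum, EuclideanSpace.real_norm_sq_eq]
    simp [Finset.sum_div, neg_div, Finset.sum_neg_distrib]
  ext A hA
  have hmp := PiLp.volume_preserving_toLp (Fin d)
  rw [Measure.map_apply (WithLp.measurable_toLp 2 _) hA,
    withDensity_apply _ ((WithLp.measurable_toLp 2 _) hA), withDensity_apply _ hA,
    ← hmp.setLIntegral_comp_preimage hA]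
  · refine lintegral_congr fun x => ?_
    rw [← hdens]
  · exact (measurable_heatKernel.comp (measurable_const.prodMk measurable_id)).ennreal_ofReal

lemma heatKernel_nonneg {d : ℕ} (s : ℝ) (x : EuclideanSpace ℝ (Fin d)) : 0 ≤ heatKernel d s x := by
  unfold heatKernel; positivity

lemma heatKernel_le_time {d : ℕ} {s : ℝ} (hs : 0 < s) (x : EuclideanSpace ℝ (Fin d)) :
    heatKernel d s x ≤ (√s)⁻¹ ^ d := by
  unfold heatKernel
  have h1 : Real.exp (-‖x‖ ^ 2 / (2 * s)) ≤ 1 := by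
    rw [Real.exp_le_one_iff, neg_div]
    have : 0 ≤ ‖x‖ ^ 2 / (2 * s) := by positivity
    linarith
  have h2 : (√(2 * Real.pi * s))⁻¹ ≤ (√s)⁻¹ := by
    apply inv_anti₀ (Real.sqrt_pos.2 hs)
    apply Real.sqrt_le_sqrt
    nlinarith [Real.pi_gt_three]
  calc _ ≤ (√s)⁻¹ ^ d * 1 := by gcongr
    _ = _ := mul_one _

lemma heatKernel_le_space {d : ℕ} (hd : 0 < d) {s : ℝ} (hs : 0 < s)
    {x : EuclideanSpace ℝ (Fin d)} (hx : x ≠ 0) :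
    heatKernel d s x ≤ √d ^ d * ‖x‖⁻¹ ^ d := by
  have hx' : 0 < ‖x‖ := norm_pos_iff.2 hx
  have hd' : (0 : ℝ) < d := by exact_mod_cast hd
  set z := ‖x‖ ^ 2 / (2 * s * d) with hz
  have hz0 : 0 < z := by positivity
  have h1 : Real.exp (-‖x‖ ^ 2 / (2 * s)) = Real.exp (-z) ^ d := by
    rw [← Real.exp_nat_mul]
    congr 1
    rw [hz]
    field_simp
  -- `e^z ≥ 1 + z ≥ √z`, so each of the `d` factors is bounded by a multiple of `1 / ‖x‖`
  have h2 : Real.exp (-z) ≤ (√z)⁻¹ := by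
    rw [Real.exp_neg]
    apply inv_anti₀ (Real.sqrt_pos.2 hz0)
    have := Real.add_one_le_exp z
    have h3 : √z ≤ z + 1 := by
      rw [Real.sqrt_le_left (by positivity)]
      nlinarith
    linarith
  have h4 : (√(2 * Real.pi * s))⁻¹ * (√z)⁻¹ ≤ √d * ‖x‖⁻¹ := by
    have : √z = ‖x‖ / √(2 * s * d) := by
      rw [hz, Real.sqrt_div (by positivity), Real.sqrt_sq hx'.le]
    rw [this, inv_div, div_eq_mul_inv, ← mul_assoc]
    gcongr
    rw [inv_mul_le_iff₀ (by positivity), ← Real.sqrt_mul (by positivity)]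
    apply Real.sqrt_le_sqrt
    have : 0 < s * d := by positivity
    nlinarith [Real.pi_gt_three]
  unfold heatKernel
  rw [h1, ← mul_pow, ← mul_pow]
  exact pow_le_pow_left₀ (by positivity) (le_trans (by gcongr) h4) d

open Set in
/-- Potential estimate in the plane: the occupation density up to time `t` is at most of order
`t^γ ‖x‖^{-2γ}`. -/
lemma lintegral_heatKernel_two {γ : ℝ} (hγ : 0 < γ) (hγ1 : γ < 1) :
    ∃ C : ℝ, 0 ≤ C ∧ ∀ (t : ℝ), 0 ≤ t → ∀ x : EuclideanSpace ℝ (Fin 2), x ≠ 0 →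
      ∫⁻ s in Icc 0 t, ENNReal.ofReal (heatKernel 2 s x) ≤
        ENNReal.ofReal (C * t ^ γ * ‖x‖ ^ (-(2 * γ))) := by
  refine ⟨2 / γ, by positivity, fun t ht x hx => ?_⟩
  have hx' : 0 < ‖x‖ := norm_pos_iff.2 hx
  -- interpolation between the two bounds on the kernel
  have hbd : ∀ s ∈ Ioc 0 t, heatKernel 2 s x ≤ 2 * ‖x‖ ^ (-(2 * γ)) * s ^ (γ - 1) := by
    intro s hs
    have hs0 : 0 < s := hs.1
    have h1 : heatKernel 2 s x ≤ 2 * s⁻¹ := by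
      refine (heatKernel_le_time hs.1 x).trans ?_
      rw [inv_pow, Real.sq_sqrt hs0.le]
      have : 0 < s⁻¹ := by positivity
      linarith
    have h2 : heatKernel 2 s x ≤ 2 * (‖x‖ ^ 2)⁻¹ := by
      refine (heatKernel_le_space (by norm_num) hs.1 hx).trans (le_of_eq ?_)
      norm_num
    set k := heatKernel 2 s x
    have hk : 0 ≤ k := heatKernel_nonneg s x
    calc k = k ^ (1 - γ) * k ^ γ := by
          rcases hk.eq_or_lt with h | h
          · rw [← h, Real.zero_rpow hγ.ne', mul_zero]
          · rw [← Real.rpow_add h]; simp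
      _ ≤ (2 * s⁻¹) ^ (1 - γ) * (2 * (‖x‖ ^ 2)⁻¹) ^ γ := by
          have : 0 ≤ 1 - γ := by linarith
          gcongr
      _ = 2 * ‖x‖ ^ (-(2 * γ)) * s ^ (γ - 1) := by
          rw [Real.mul_rpow (by norm_num) (by positivity),
            Real.mul_rpow (by norm_num) (by positivity), Real.inv_rpow hs0.le, ← Real.rpow_neg hs0.le,
            Real.inv_rpow (by positivity), ← Real.rpow_natCast, ← Real.rpow_mul hx'.le,
            ← Real.rpow_neg hx'.le, neg_sub]
          have : (2 : ℝ) ^ (1 - γ) * 2 ^ γ = 2 := by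
            rw [← Real.rpow_add (by norm_num)]; simp
          push_cast
          linear_combination (s ^ (γ - 1) * ‖x‖ ^ (-(2 * γ))) * this
  rw [← restrict_Ioc_eq_restrict_Icc]
  have hint : IntegrableOn (fun s : ℝ => 2 * ‖x‖ ^ (-(2 * γ)) * s ^ (γ - 1)) (Ioc 0 t) := by
    have := (intervalIntegral.intervalIntegrable_rpow' (a := 0) (b := t)
      (show -1 < γ - 1 by linarith)).const_mul (2 * ‖x‖ ^ (-(2 * γ)))
    rwa [intervalIntegrable_iff_integrableOn_Ioc_of_le ht] at this
  calc ∫⁻ s in Ioc 0 t, ENNReal.ofReal (heatKernel 2 s x)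
      ≤ ∫⁻ s in Ioc 0 t, ENNReal.ofReal (2 * ‖x‖ ^ (-(2 * γ)) * s ^ (γ - 1)) :=
        setLIntegral_mono_ae (by fun_prop)
          (ae_of_all _ fun s hs => ENNReal.ofReal_le_ofReal (hbd s hs))
    _ = ENNReal.ofReal (∫ s in Ioc 0 t, 2 * ‖x‖ ^ (-(2 * γ)) * s ^ (γ - 1)) := by
        rw [ofReal_integral_eq_lintegral_ofReal hint]
        refine (ae_restrict_iff' measurableSet_Ioc).2 (ae_of_all _ fun s hs => ?_)
        have : 0 < s := hs.1
        positivity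
    _ = ENNReal.ofReal (2 / γ * t ^ γ * ‖x‖ ^ (-(2 * γ))) := by
        rw [← intervalIntegral.integral_of_le ht, intervalIntegral.integral_const_mul,
          integral_rpow (Or.inl (by linarith)), sub_add_cancel, Real.zero_rpow hγ.ne']
        congr 1
        ring

open Set in
/-- Potential estimate in dimension `d > 2`: the Green function of the Wiener process is at most of
order `‖x‖^{2-d}`. -/
lemma lintegral_heatKernel_of_two_lt {d : ℕ} (hd : 2 < d) :
    ∃ C : ℝ, 0 ≤ C ∧ ∀ (t : ℝ), ∀ x : EuclideanSpace ℝ (Fin d), x ≠ 0 →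
      ∫⁻ s in Icc 0 t, ENNReal.ofReal (heatKernel d s x) ≤
        ENNReal.ofReal (C * ‖x‖ ^ (2 - (d : ℝ))) := by
  have hd' : (2 : ℝ) < d := by exact_mod_cast hd
  refine ⟨√d ^ d + 1 / ((d : ℝ) / 2 - 1), ?_, fun t x hx => ?_⟩
  · have : 0 < (d : ℝ) / 2 - 1 := by linarith
    positivity
  have hx' : 0 < ‖x‖ := norm_pos_iff.2 hx
  have hd2 : 0 < (d : ℝ) / 2 - 1 := by linarith
  have hpow : ∀ r : ℝ, 0 < r → r⁻¹ ^ d = r ^ (-(d : ℝ)) := by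
    intro r hr
    rw [Real.rpow_neg hr.le, Real.rpow_natCast, inv_pow]
  rw [← restrict_Ioc_eq_restrict_Icc]
  -- use the space bound up to time `‖x‖ ^ 2` and the time bound afterwards
  have hsub : Ioc 0 t ⊆ Ioc 0 (‖x‖ ^ 2) ∪ Ioi (‖x‖ ^ 2) := by
    intro s hs
    rcases le_or_gt s (‖x‖ ^ 2) with h | h
    · exact Or.inl ⟨hs.1, h⟩
    · exact Or.inr h
  have hA : ∫⁻ s in Ioc 0 (‖x‖ ^ 2), ENNReal.ofReal (heatKernel d s x) ≤
      ENNReal.ofReal (√d ^ d * ‖x‖ ^ (2 - (d : ℝ))) := by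
    calc _ ≤ ∫⁻ s in Ioc 0 (‖x‖ ^ 2), ENNReal.ofReal (√d ^ d * ‖x‖⁻¹ ^ d) :=
          setLIntegral_mono_ae measurable_const.aemeasurable (ae_of_all _ fun s hs =>
            ENNReal.ofReal_le_ofReal (heatKernel_le_space (by lia) hs.1 hx))
      _ = _ := by
          rw [setLIntegral_const, Real.volume_Ioc, sub_zero, ← ENNReal.ofReal_mul (by positivity),
            mul_assoc, hpow _ hx', sub_eq_neg_add, Real.rpow_add hx']
          norm_num
  have hB : ∫⁻ s in Ioi (‖x‖ ^ 2), ENNReal.ofReal (heatKernel d s x) ≤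
      ENNReal.ofReal (1 / ((d : ℝ) / 2 - 1) * ‖x‖ ^ (2 - (d : ℝ))) := by
    have hx2 : 0 < ‖x‖ ^ 2 := by positivity
    have hlt : -((d : ℝ) / 2) < -1 := by linarith
    calc _ ≤ ∫⁻ s in Ioi (‖x‖ ^ 2), ENNReal.ofReal (s ^ (-((d : ℝ) / 2))) := by
          refine setLIntegral_mono_ae (by fun_prop) (ae_of_all _ fun s hs => ?_)
          have hs0 : 0 < s := hx2.trans hs
          refine ENNReal.ofReal_le_ofReal ((heatKernel_le_time hs0 x).trans (le_of_eq ?_))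
          rw [hpow _ (Real.sqrt_pos.2 hs0), Real.sqrt_eq_rpow, ← Real.rpow_mul hs0.le]
          congr 1
          ring
      _ = ENNReal.ofReal (∫ s in Ioi (‖x‖ ^ 2), s ^ (-((d : ℝ) / 2))) := by
          rw [ofReal_integral_eq_lintegral_ofReal (integrableOn_Ioi_rpow_of_lt hlt hx2)]
          refine (ae_restrict_iff' measurableSet_Ioi).2 (ae_of_all _ fun s hs => ?_)
          have hs0 : 0 < s := hx2.trans hs
          positivity
      _ = _ := by
          rw [integral_Ioi_rpow_of_lt hlt hx2, ← Real.rpow_natCast, ← Real.rpow_mul hx'.le]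
          congr 1
          rw [show ((2 : ℕ) : ℝ) * (-((d : ℝ) / 2) + 1) = 2 - d by push_cast; ring]
          rw [show -((d : ℝ) / 2) + 1 = -((d : ℝ) / 2 - 1) by ring, neg_div_neg_eq, one_div,
            inv_mul_eq_div]
  calc _ ≤ ∫⁻ s in Ioc 0 (‖x‖ ^ 2) ∪ Ioi (‖x‖ ^ 2), ENNReal.ofReal (heatKernel d s x) :=
        lintegral_mono_set hsub
    _ ≤ _ := (lintegral_union_le _ _ _).trans (add_le_add hA hB)
    _ = _ := by
        rw [← ENNReal.ofReal_add (by positivity) (by positivity)]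
        congr 1
        ring

/-! ### Expectations of additive functionals -/

lemma measurable_additiveFunctional {d : ℕ} {g : EuclideanSpace ℝ (Fin d) → ℝ≥0∞}
    (hg : Measurable g) (t : ℝ≥0) :
    Measurable (fun w : PathSpace d => additiveFunctional g w.1 t) := by
  have h : Measurable fun p : PathSpace d × ℝ => g (p.1.1 p.2.toNNReal) :=
    hg.comp (measurable_uncurry_path.comp
      (measurable_fst.prodMk (measurable_real_toNNReal.comp measurable_snd)))
  exact h.lintegral_prod_right'

lemma ae_restrict_Icc_pos (t : ℝ) : ∀ᵐ s ∂(volume.restrict (Set.Icc (0 : ℝ) t)), 0 < s := by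
  rw [← restrict_Ioc_eq_restrict_Icc]
  exact (ae_restrict_iff' measurableSet_Ioc).2 (ae_of_all _ fun s hs => hs.1)

/-- The expectation of an additive functional in terms of the Gaussian densities. -/
lemma IsWienerProcess.lintegral_additiveFunctional {d : ℕ} {μ : Measure (PathSpace d)}
    [IsProbabilityMeasure μ] (hμ : IsWienerProcess (canonicalProcess d) μ)
    {g : EuclideanSpace ℝ (Fin d) → ℝ≥0∞} (hg : Measurable g) (t : ℝ≥0) :
    ∫⁻ w, additiveFunctional g w.1 t ∂μ =
      ∫⁻ s in Set.Icc (0 : ℝ) t, ∫⁻ x, g x * ENNReal.ofReal (heatKernel d s x) := by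
  have h : Measurable fun p : PathSpace d × ℝ => g (p.1.1 p.2.toNNReal) :=
    hg.comp (measurable_uncurry_path.comp
      (measurable_fst.prodMk (measurable_real_toNNReal.comp measurable_snd)))
  unfold additiveFunctional
  rw [lintegral_lintegral_swap h.aemeasurable]
  refine lintegral_congr_ae ?_
  filter_upwards [ae_restrict_Icc_pos t] with s hs
  have hs' : s.toNNReal ≠ 0 := (Real.toNNReal_pos.2 hs).ne'
  have hk : Measurable fun x : EuclideanSpace ℝ (Fin d) => ENNReal.ofReal (heatKernel d s x) :=
    measurable_heatKernel.ennreal_ofReal.comp (measurable_const.prodMk measurable_id)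
  have h1 := lintegral_map (μ := μ) hg (measurable_canonicalProcess s.toNNReal)
  rw [hμ.map_eval hs', Real.coe_toNNReal s hs.le, lintegral_withDensity_eq_lintegral_mul _ hk hg]
    at h1
  refine h1.symm.trans (lintegral_congr fun x => ?_)
  simp [mul_comm]

lemma IsWienerProcess.lintegral_heatKernel {d : ℕ} {μ : Measure (PathSpace d)}
    [IsProbabilityMeasure μ] (hμ : IsWienerProcess (canonicalProcess d) μ) {s : ℝ} (hs : 0 < s) :
    ∫⁻ x, ENNReal.ofReal (heatKernel d s x) = 1 := by
  have hs' : s.toNNReal ≠ 0 := (Real.toNNReal_pos.2 hs).ne'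
  have := Measure.isProbabilityMeasure_map (μ := μ)
    (measurable_canonicalProcess (d := d) s.toNNReal).aemeasurable
  have h1 : (μ.map (canonicalProcess d s.toNNReal)) Set.univ = 1 := measure_univ
  rwa [hμ.map_eval hs', Real.coe_toNNReal s hs.le, withDensity_apply _ MeasurableSet.univ,
    setLIntegral_univ] at h1

/-- Splitting at radius `R`: outside the ball the integrand is at most `ε`, and inside the
occupation density of the Wiener process is controlled by the potential estimate. -/
lemma IsWienerProcess.lintegral_additiveFunctional_le {d : ℕ} (hd : 0 < d)
    {μ : Measure (PathSpace d)}
    [IsProbabilityMeasure μ] (hμ : IsWienerProcess (canonicalProcess d) μ) {a θ C : ℝ}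
    (hC : 0 ≤ C)
    (hpot : ∀ t : ℝ, 0 ≤ t → ∀ x : EuclideanSpace ℝ (Fin d), x ≠ 0 →
      ∫⁻ s in Set.Icc 0 t, ENNReal.ofReal (heatKernel d s x) ≤
        ENNReal.ofReal (C * t ^ θ * ‖x‖ ^ (-a)))
    {g : EuclideanSpace ℝ (Fin d) → ℝ≥0∞} (hg : Measurable g) {R : ℝ} {ε : ℝ≥0∞}
    (hR : ∀ᵐ x : EuclideanSpace ℝ (Fin d), R < ‖x‖ → g x ≤ ε) (t : ℝ≥0) :
    ∫⁻ w, additiveFunctional g w.1 t ∂μ ≤ ε * t + ENNReal.ofReal (C * (t : ℝ) ^ θ) *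
      ∫⁻ x in Metric.closedBall 0 R, g x * ENNReal.ofReal (‖x‖ ^ (-a)) := by
  have : Nonempty (Fin d) := ⟨⟨0, hd⟩⟩
  have hhm : Measurable fun p : ℝ × EuclideanSpace ℝ (Fin d) =>
      ENNReal.ofReal (heatKernel d p.1 p.2) := measurable_heatKernel.ennreal_ofReal
  have hh1 : ∀ s, Measurable fun x => ENNReal.ofReal (heatKernel d s x) := fun s =>
    hhm.comp (measurable_const.prodMk measurable_id)
  have hh2 : ∀ x, Measurable fun s => ENNReal.ofReal (heatKernel d s x) := fun x =>
    hhm.comp (measurable_id.prodMk measurable_const)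
  have hgh : Measurable fun p : ℝ × EuclideanSpace ℝ (Fin d) =>
      g p.2 * ENNReal.ofReal (heatKernel d p.1 p.2) := (hg.comp measurable_snd).mul hhm
  rw [hμ.lintegral_additiveFunctional hg]
  have hsplit : ∀ s, 0 < s → ∫⁻ x, g x * ENNReal.ofReal (heatKernel d s x) ≤
      ε + ∫⁻ x in Metric.closedBall 0 R, g x * ENNReal.ofReal (heatKernel d s x) := by
    intro s hs
    rw [← lintegral_indicator Metric.isClosed_closedBall.measurableSet]
    calc _ ≤ ∫⁻ x, (ε * ENNReal.ofReal (heatKernel d s x) + (Metric.closedBall 0 R).indicator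
          (fun x => g x * ENNReal.ofReal (heatKernel d s x)) x) := by
          refine lintegral_mono_ae ?_
          filter_upwards [hR] with x hx
          by_cases h : x ∈ Metric.closedBall (0 : EuclideanSpace ℝ (Fin d)) R
          · rw [Set.indicator_of_mem h]
            exact le_add_self
          · rw [Set.indicator_of_notMem h, add_zero]
            gcongr
            exact hx (by simpa using h)
      _ = _ := by
          rw [lintegral_add_left ((hh1 s).const_mul ε), lintegral_const_mul _ (hh1 s),
            hμ.lintegral_heatKernel hs, mul_one]
  calc _ ≤ ∫⁻ s in Set.Icc (0 : ℝ) t, (ε + ∫⁻ x in Metric.closedBall 0 R,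
          g x * ENNReal.ofReal (heatKernel d s x)) := by
        refine lintegral_mono_ae ?_
        filter_upwards [ae_restrict_Icc_pos t] with s hs using hsplit s hs
    _ = ε * t + ∫⁻ x in Metric.closedBall 0 R, ∫⁻ s in Set.Icc (0 : ℝ) t,
          g x * ENNReal.ofReal (heatKernel d s x) := by
        rw [lintegral_add_left measurable_const, setLIntegral_const, Real.volume_Icc, sub_zero,
          ENNReal.ofReal_coe_nnreal, lintegral_lintegral_swap hgh.aemeasurable]
    _ ≤ ε * t + ∫⁻ x in Metric.closedBall 0 R, ENNReal.ofReal (C * (t : ℝ) ^ θ) *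
          (g x * ENNReal.ofReal (‖x‖ ^ (-a))) := by
        refine add_le_add le_rfl ?_
        refine lintegral_mono_ae (ae_restrict_of_ae ?_)
        have hne : ∀ᵐ x : EuclideanSpace ℝ (Fin d), x ≠ 0 :=
          measure_eq_zero_iff_ae_notMem.1 (measure_singleton (0 : EuclideanSpace ℝ (Fin d)))
        filter_upwards [hne] with x hx
        rw [lintegral_const_mul _ (hh2 x)]
        calc _ ≤ g x * ENNReal.ofReal (C * (t : ℝ) ^ θ * ‖x‖ ^ (-a)) := by
              gcongr
              exact hpot t t.2 x hx
          _ = _ := by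
              rw [ENNReal.ofReal_mul (mul_nonneg hC (Real.rpow_nonneg t.coe_nonneg θ))]
              ring
    _ = _ := by
        rw [lintegral_const_mul]
        exact hg.mul (by fun_prop)

/-- The time average of the expectation of an additive functional whose density vanishes at
infinity tends to `0`; in particular these expectations are finite. -/
lemma IsWienerProcess.tendsto_lintegral_additiveFunctional_div {d : ℕ} (hd : 0 < d)
    {μ : Measure (PathSpace d)}
    [IsProbabilityMeasure μ] (hμ : IsWienerProcess (canonicalProcess d) μ) {a θ C : ℝ}
    (hC : 0 ≤ C) (hθ : θ < 1)
    (hpot : ∀ t : ℝ, 0 ≤ t → ∀ x : EuclideanSpace ℝ (Fin d), x ≠ 0 →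
      ∫⁻ s in Set.Icc 0 t, ENNReal.ofReal (heatKernel d s x) ≤
        ENNReal.ofReal (C * t ^ θ * ‖x‖ ^ (-a)))
    {g : EuclideanSpace ℝ (Fin d) → ℝ≥0∞} (hg : Measurable g)
    (hball : ∀ R : ℝ, 0 < R →
      ∫⁻ x in Metric.closedBall 0 R, g x * ENNReal.ofReal (‖x‖ ^ (-a)) ≠ ∞)
    (hinf : ∀ ε : ℝ≥0∞, 0 < ε → ∃ R : ℝ, 0 < R ∧
      ∀ᵐ x : EuclideanSpace ℝ (Fin d), R < ‖x‖ → g x ≤ ε) :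
    (∀ t : ℝ≥0, ∫⁻ w, additiveFunctional g w.1 t ∂μ ≠ ∞) ∧
    Tendsto (fun t : ℝ≥0 => (∫⁻ w, additiveFunctional g w.1 t ∂μ) / t) atTop (𝓝 0) := by
  constructor
  · intro t
    obtain ⟨R, hR0, hR⟩ := hinf 1 one_pos
    refine ne_top_of_le_ne_top ?_ (hμ.lintegral_additiveFunctional_le hd hC hpot hg hR t)
    exact ENNReal.add_ne_top.2 ⟨by simp, ENNReal.mul_ne_top ENNReal.ofReal_ne_top (hball R hR0)⟩
  rw [ENNReal.tendsto_nhds_zero]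
  intro ε hε
  obtain ⟨R, hR0, hR⟩ := hinf (ε / 2) (ENNReal.half_pos hε.ne')
  set I := ∫⁻ x in Metric.closedBall 0 R, g x * ENNReal.ofReal (‖x‖ ^ (-a)) with hI
  have hI' : I ≠ ∞ := hball R hR0
  have hlim : Tendsto (fun t : ℝ≥0 => ENNReal.ofReal (C * (t : ℝ) ^ (θ - 1)) * I) atTop (𝓝 0) := by
    have h1 : Tendsto (fun t : ℝ≥0 => C * (t : ℝ) ^ (θ - 1)) atTop (𝓝 0) := by
      have h2 := (tendsto_rpow_neg_atTop (show 0 < 1 - θ by linarith)).comp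
        (NNReal.tendsto_coe_atTop.2 tendsto_id)
      simpa [neg_sub, Function.comp_def] using h2.const_mul C
    have h3 := ENNReal.Tendsto.mul_const (ENNReal.tendsto_ofReal h1) (Or.inr hI')
    simpa using h3
  filter_upwards [ENNReal.tendsto_nhds_zero.1 hlim (ε / 2) (ENNReal.half_pos hε.ne'),
    eventually_gt_atTop 0] with t ht ht0
  have ht0' : (0 : ℝ) < t := ht0
  have htE : (t : ℝ≥0∞) ≠ 0 := by exact_mod_cast ht0.ne'
  calc _ ≤ (ε / 2 * t + ENNReal.ofReal (C * (t : ℝ) ^ θ) * I) / t :=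
        ENNReal.div_le_div_right (hμ.lintegral_additiveFunctional_le hd hC hpot hg hR t) _
    _ = ε / 2 + ENNReal.ofReal (C * (t : ℝ) ^ (θ - 1)) * I := by
        rw [ENNReal.add_div, ENNReal.mul_div_cancel_right htE ENNReal.coe_ne_top,
          Real.rpow_sub_one ht0'.ne', ← mul_div_assoc, ENNReal.ofReal_div_of_pos ht0',
          ENNReal.ofReal_coe_nnreal]
        simp only [div_eq_mul_inv]
        ring
    _ ≤ ε / 2 + ε / 2 := by gcongr
    _ = ε := ENNReal.add_halves ε

/-! ### Clocks and time changes -/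

lemma lintegral_Icc_add_Ioc {h : ℝ → ℝ≥0∞} {a b c : ℝ} (hab : a ≤ b) (hbc : b ≤ c) :
    ∫⁻ s in Set.Icc a c, h s = (∫⁻ s in Set.Icc a b, h s) + ∫⁻ s in Set.Ioc b c, h s := by
  rw [← Set.Icc_union_Ioc_eq_Icc hab hbc, lintegral_union measurableSet_Ioc]
  exact Set.disjoint_left.2 fun x hx hx' => not_lt_of_ge hx.2 hx'.1

/-- The primitive of an a.e. positive function with finite integrals over bounded intervals and
infinite total integral is a clock. -/
lemma isClock_lintegral {h : ℝ → ℝ≥0∞} (hm : Measurable h) (hne : ∀ s, h s ≠ ∞)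
    (hpos : ∀ᵐ s ∂(volume.restrict (Set.Ici (0 : ℝ))), h s ≠ 0)
    (hfin : ∀ t : ℝ≥0, ∫⁻ s in Set.Icc (0 : ℝ) t, h s ≠ ∞)
    (htop : ∀ K : ℕ, ∃ t : ℝ≥0, (K : ℝ≥0∞) ≤ ∫⁻ s in Set.Icc (0 : ℝ) t, h s) :
    IsClock (fun t : ℝ≥0 => ∫⁻ s in Set.Icc (0 : ℝ) t, h s) := by
  have hstrict : StrictMono (fun t : ℝ≥0 => ∫⁻ s in Set.Icc (0 : ℝ) t, h s) := by
    intro s t hst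
    have hst' : (s : ℝ) < t := hst
    simp only
    rw [lintegral_Icc_add_Ioc s.2 hst'.le]
    refine ENNReal.lt_add_right (hfin s) fun h0 => ?_
    rw [lintegral_eq_zero_iff hm] at h0
    have hsub : Set.Ioc (s : ℝ) t ⊆ Set.Ici 0 := fun x hx => s.2.trans hx.1.le
    have h1 := ae_mono (Measure.restrict_mono hsub le_rfl) hpos
    have h2 : ∀ᵐ x ∂(volume.restrict (Set.Ioc (s : ℝ) t)), False := by
      filter_upwards [h0, h1] with x hx hx'
      exact hx' hx
    rw [ae_iff] at h2
    simp only [not_false_eq_true, Set.ofPred_true, Measure.restrict_apply_univ, Real.volume_Ioc,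
      ENNReal.ofReal_eq_zero] at h2
    linarith
  refine ⟨by simp, fun t => (hfin t).lt_top, ?_, hstrict, ?_⟩
  · set k : ℝ → ℝ := (Set.Ici 0).indicator fun s => (h s).toReal with hk
    have hkint : ∀ a b, IntervalIntegrable k volume a b := by
      have hI : ∀ a b, IntegrableOn k (Set.Ioc a b) := by
        intro a b
        rw [hk, integrableOn_indicator_iff measurableSet_Ici]
        have : IntegrableOn (fun s => (h s).toReal) (Set.Icc 0 (max b 0)) :=
          integrable_toReal_of_lintegral_ne_top hm.aemeasurable (hfin ⟨max b 0, le_max_right _ _⟩)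
        exact this.mono_set fun x hx => ⟨hx.1, hx.2.2.trans (le_max_left _ _)⟩
      exact fun a b => ⟨hI a b, hI b a⟩
    have hc := intervalIntegral.continuous_primitive hkint 0
    have heq : (fun t : ℝ≥0 => ∫⁻ s in Set.Icc (0 : ℝ) t, h s) =
        fun t : ℝ≥0 => ENNReal.ofReal (∫ x in (0 : ℝ)..t, k x) := by
      funext t
      have ht : (0 : ℝ) ≤ t := t.2
      rw [intervalIntegral.integral_of_le ht, ofReal_integral_eq_lintegral_ofReal (hkint 0 t).1,
        restrict_Ioc_eq_restrict_Icc]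
      · refine setLIntegral_congr_fun measurableSet_Icc fun s hs => ?_
        simp only [hk]
        rw [Set.indicator_of_mem (show s ∈ Set.Ici (0 : ℝ) from hs.1), ENNReal.ofReal_toReal (hne s)]
      · exact ae_of_all _ fun s => Set.indicator_nonneg (fun _ _ => ENNReal.toReal_nonneg) s
    rw [heq]
    exact ENNReal.continuous_ofReal.comp (hc.comp NNReal.continuous_coe)
  · refine tendsto_atTop_isLUB hstrict.monotone ?_
    refine ⟨fun _ _ => le_top, fun b hb => ?_⟩
    rw [top_le_iff]
    by_contra hbne
    obtain ⟨K, hK⟩ := ENNReal.exists_nat_gt hbne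
    obtain ⟨t, ht⟩ := htop K
    exact absurd (hb (Set.mem_range_self t)) (not_le.2 (hK.trans_le ht))

namespace IsClock

variable {A : ℝ≥0 → ℝ≥0∞}

lemma exists_eq (hA : IsClock A) (t : ℝ≥0) : ∃ u, A u = t := by
  have h1 : ∃ a, A a ≤ t := ⟨0, by simp [hA.zero]⟩
  have h2 : ∃ a, (t : ℝ≥0∞) ≤ A a :=
    ((hA.tendsto_top.eventually (lt_mem_nhds ENNReal.coe_lt_top)).exists).imp fun _ h => h.le
  exact mem_range_of_exists_le_of_exists_ge hA.continuous h1 h2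

lemma rightInverse_eq (hA : IsClock A) {u t : ℝ≥0} (hu : A u = t) : rightInverse A t = u := by
  unfold rightInverse
  apply le_antisymm
  · refine le_of_forall_gt_imp_ge_of_dense fun b hb => ?_
    obtain ⟨v, huv, hvb⟩ := ENNReal.lt_iff_exists_nnreal_btwn.1 hb
    have huv' : u < v := by exact_mod_cast huv
    exact (iInf₂_le v ⟨bot_le.trans_lt huv', hu ▸ hA.strictMono huv'⟩).trans hvb.le
  · refine le_iInf₂ fun v hv => ?_
    rw [← hu] at hv
    exact_mod_cast (hA.strictMono.lt_iff_lt.1 hv.2).le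

lemma timeChange_eq {E : Type*} (hA : IsClock A) (w : ℝ≥0 → E) {u t : ℝ≥0} (hu : A u = t) :
    timeChange w A t = w u := by
  rw [timeChange, hA.rightInverse_eq hu, ENNReal.toNNReal_coe]

lemma apply_rightInverse (hA : IsClock A) (t : ℝ≥0) : A (rightInverse A t).toNNReal = t := by
  obtain ⟨u, hu⟩ := hA.exists_eq t
  rw [hA.rightInverse_eq hu, ENNReal.toNNReal_coe, hu]

lemma continuous_rightInverse (hA : IsClock A) :
    Continuous fun t => (rightInverse A t).toNNReal := by
  refine Monotone.continuous_of_surjective (fun s t hst => ?_) fun u => ?_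
  · rw [← hA.strictMono.le_iff_le, hA.apply_rightInverse, hA.apply_rightInverse]
    exact_mod_cast hst
  · refine ⟨(A u).toNNReal, ?_⟩
    rw [hA.rightInverse_eq (ENNReal.coe_toNNReal (hA.finite u).ne).symm, ENNReal.toNNReal_coe]

lemma continuous_timeChange {E : Type*} [TopologicalSpace E] (hA : IsClock A) {w : ℝ≥0 → E}
    (hw : Continuous w) : Continuous (timeChange w A) :=
  hw.comp hA.continuous_rightInverse

/-- A linear rescaling `v ↦ c⁻¹ A(c v)` of a clock is a clock. -/
lemma of_scaling (hA : IsClock A) {A' : ℝ≥0 → ℝ≥0∞} {c : ℝ≥0} (hc : c ≠ 0)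
    (h : ∀ v, A (c * v) = c * A' v) : IsClock A' := by
  have hc0 : (c : ℝ≥0∞) ≠ 0 := by exact_mod_cast hc
  have h' : A' = fun v => (c : ℝ≥0∞)⁻¹ * A (c * v) := by
    funext v
    rw [h, ← mul_assoc, ENNReal.inv_mul_cancel hc0 ENNReal.coe_ne_top, one_mul]
  have hci : (c : ℝ≥0∞)⁻¹ ≠ ∞ := ENNReal.inv_ne_top.2 hc0
  have hci0 : (c : ℝ≥0∞)⁻¹ ≠ 0 := ENNReal.inv_ne_zero.2 ENNReal.coe_ne_top
  rw [h']
  refine ⟨by simp [hA.zero], fun t => ENNReal.mul_lt_top hci.lt_top (hA.finite _), ?_, ?_, ?_⟩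
  · exact (ENNReal.continuous_const_mul hci).comp
      (hA.continuous.comp (continuous_const.mul continuous_id))
  · intro s t hst
    exact (ENNReal.mul_lt_mul_iff_right hci0 hci).2
      (hA.strictMono (mul_lt_mul_of_pos_left hst (pos_iff_ne_zero.2 hc)))
  · have h1 := hA.tendsto_top.comp (tendsto_id.const_mul_atTop (pos_iff_ne_zero.2 hc))
    simpa [ENNReal.mul_top hci0] using
      ENNReal.Tendsto.const_mul (a := (c : ℝ≥0∞)⁻¹) h1 (Or.inl ENNReal.top_ne_zero)

/-- If the clock `ν` runs at least at speed `c` and `A` is within `δ` of `ν` up to time `M`, then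
the inverses of `A` and `ν` differ by at most `δ / c` up to time `T < c M - δ`. -/
lemma inverse_le_and_dist_le {ν : ℝ≥0 → ℝ≥0∞} (hA : IsClock A) (hν : IsClock ν) {c δ M T : ℝ≥0}
    (hc : 0 < c) (hspeed : ∀ u v, u ≤ v → ν u + c * ((v - u : ℝ≥0) : ℝ≥0∞) ≤ ν v)
    (h1 : ∀ v ≤ M, A v ≤ ν v + δ) (h2 : ∀ v ≤ M, ν v ≤ A v + δ) (hM : T + δ < c * M)
    {t u v : ℝ≥0} (ht : t ≤ T) (hu : A u = t) (hv : ν v = t) :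
    u ≤ M ∧ v ≤ M ∧ dist u v ≤ δ / c := by
  have hνM : (c : ℝ≥0∞) * M ≤ ν M := by
    have := hspeed 0 M bot_le
    rwa [hν.zero, zero_add, tsub_zero] at this
  have hM' : (T : ℝ≥0∞) + δ < ν M := lt_of_lt_of_le (by exact_mod_cast hM) hνM
  have htT : (t : ℝ≥0∞) ≤ T := by exact_mod_cast ht
  have huM : u ≤ M := by
    by_contra! hcon
    have h3 : A M < t := hu ▸ hA.strictMono hcon
    have h4 : A M + δ < ν M := lt_of_le_of_lt (by gcongr; exact h3.le.trans htT) hM'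
    exact absurd (h2 M le_rfl) (not_le.2 h4)
  have hvM : v ≤ M := by
    by_contra! hcon
    have h3 : ν M < t := hv ▸ hν.strictMono hcon
    exact absurd (h3.trans_le htT) (not_lt.2 (le_self_add.trans hM'.le))
  refine ⟨huM, hvM, ?_⟩
  have hcδ : ∀ r : ℝ≥0, (c : ℝ≥0∞) * r ≤ δ → (r : ℝ) ≤ δ / c := by
    intro r hr
    rw [le_div_iff₀ (by exact_mod_cast hc), mul_comm]
    exact_mod_cast hr
  rcases le_total u v with huv | huv
  · have h3 : ν u + c * ((v - u : ℝ≥0) : ℝ≥0∞) ≤ ν u + δ :=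
      (hspeed u v huv).trans (by rw [hv, ← hu]; exact h1 u huM)
    have h4 := hcδ _ ((ENNReal.add_le_add_iff_left (hν.finite u).ne).1 h3)
    rw [NNReal.dist_eq, abs_sub_comm, abs_of_nonneg (sub_nonneg.2 (by exact_mod_cast huv))]
    rwa [NNReal.coe_sub huv] at h4
  · have h3 : ν v + c * ((u - v : ℝ≥0) : ℝ≥0∞) ≤ ν v + δ :=
      (hspeed v u huv).trans (by rw [hv, ← hu]; exact h2 u huM)
    have h4 := hcδ _ ((ENNReal.add_le_add_iff_left (hν.finite v).ne).1 h3)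
    rw [NNReal.dist_eq, abs_of_nonneg (sub_nonneg.2 (by exact_mod_cast huv))]
    rwa [NNReal.coe_sub huv] at h4

end IsClock

lemma restrictPath_apply {E : Type*} [TopologicalSpace E] [Zero E] {T : ℝ≥0} {w : ℝ≥0 → E}
    (hw : Continuous w) (t : Set.Icc (0 : ℝ≥0) T) : restrictPath T w t = w t := by
  have h : Continuous fun t : Set.Icc (0 : ℝ≥0) T => w t := hw.comp continuous_subtype_val
  rw [restrictPath, dif_pos h]
  rfl

/-- Stability of time changes: if the clocks `A n` converge to `ν` uniformly on a long enough
interval, the time-changed paths converge uniformly on `[0, T]`. -/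
lemma tendsto_restrictPath_timeChange {E : Type*} [SeminormedAddCommGroup E] {w : ℝ≥0 → E}
    (hw : Continuous w) {A : ℕ → ℝ≥0 → ℝ≥0∞} {ν : ℝ≥0 → ℝ≥0∞} (hA : ∀ᶠ n in atTop, IsClock (A n))
    (hν : IsClock ν) {c M T : ℝ≥0} (hc : 0 < c)
    (hspeed : ∀ u v, u ≤ v → ν u + c * ((v - u : ℝ≥0) : ℝ≥0∞) ≤ ν v) {D : ℕ → ℝ≥0∞}
    (hD : Tendsto D atTop (𝓝 0)) (h1 : ∀ n, ∀ v ≤ M, A n v ≤ ν v + D n)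
    (h2 : ∀ n, ∀ v ≤ M, ν v ≤ A n v + D n) (hM : T < c * M) :
    Tendsto (fun n => restrictPath T (timeChange w (A n))) atTop
      (𝓝 (restrictPath T (timeChange w ν))) := by
  rw [ContinuousMap.tendsto_iff_tendstoUniformly, Metric.tendstoUniformly_iff]
  intro ε hε
  have huc : UniformContinuousOn w (Set.Icc 0 M) :=
    isCompact_Icc.uniformContinuousOn_of_continuous hw.continuousOn
  obtain ⟨η, hη, hwη⟩ := Metric.uniformContinuousOn_iff.1 huc ε hε
  lift η to ℝ≥0 using hη.le
  have hη' : 0 < η := by exact_mod_cast hη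
  obtain ⟨δ, hδ0, hδ⟩ := exists_between
    (lt_min (mul_pos hη' hc) (tsub_pos_of_lt hM) : 0 < min (η * c) (c * M - T))
  have hδM : T + δ < c * M := by
    have := lt_tsub_iff_left.1 (hδ.trans_le (min_le_right _ _))
    exact this
  have hδη : (δ : ℝ) / c < η := by
    rw [div_lt_iff₀ (by exact_mod_cast hc)]
    exact_mod_cast hδ.trans_le (min_le_left _ _)
  filter_upwards [hA, ENNReal.tendsto_nhds_zero.1 hD δ (by exact_mod_cast hδ0)] with n hn hDn t
  rw [restrictPath_apply (hν.continuous_timeChange hw),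
    restrictPath_apply (hn.continuous_timeChange hw)]
  obtain ⟨u, hu⟩ := hn.exists_eq t
  obtain ⟨v, hv⟩ := hν.exists_eq t
  rw [hn.timeChange_eq w hu, hν.timeChange_eq w hv]
  obtain ⟨huM, hvM, hdist⟩ := hn.inverse_le_and_dist_le hν hc hspeed
    (fun v hv => (h1 n v hv).trans (by gcongr)) (fun v hv => (h2 n v hv).trans (by gcongr))
    hδM t.2.2 hu hv
  exact hwη v ⟨bot_le, hvM⟩ u ⟨bot_le, huM⟩ (by rw [dist_comm]; exact hdist.trans_lt hδη)

/-- Brownian scaling of an additive functional. -/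
lemma additiveFunctional_scaling {d : ℕ} (g : EuclideanSpace ℝ (Fin d) → ℝ≥0∞) (w : PathSpace d)
    {c : ℝ≥0} (hc : c ≠ 0) (t : ℝ≥0) :
    additiveFunctional g w.1 (c * t) =
      c * additiveFunctional (fun x => g (√(c : ℝ) • x)) (brownianScaling c w).1 t := by
  have hc0 : (0 : ℝ) < c := by exact_mod_cast pos_iff_ne_zero.2 hc
  have h1 : ∀ s : ℝ≥0, g (√(c : ℝ) • (brownianScaling c w).1 s) = g (w.1 (c * s)) := by
    intro s
    simp only [brownianScaling]
    rw [smul_smul, mul_inv_cancel₀ (Real.sqrt_pos.2 hc0).ne', one_smul]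
  unfold additiveFunctional
  simp_rw [h1]
  have hvol : (volume : Measure ℝ) = ENNReal.ofReal c • Measure.map (fun s => (c : ℝ) * s) volume := by
    rw [Real.map_volume_mul_left hc0.ne', smul_smul, ← ENNReal.ofReal_mul hc0.le,
      abs_of_pos (inv_pos.2 hc0), mul_inv_cancel₀ hc0.ne', ENNReal.ofReal_one, one_smul]
  have hpre : (fun s => (c : ℝ) * s) ⁻¹' Set.Icc (0 : ℝ) ((c * t : ℝ≥0) : ℝ) = Set.Icc 0 (t : ℝ) := by
    ext s
    simp only [Set.mem_preimage, Set.mem_Icc, NNReal.coe_mul]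
    rw [mul_nonneg_iff_of_pos_left hc0, mul_le_mul_iff_right₀ hc0]
  have he : MeasurableEmbedding (fun s => (c : ℝ) * s) :=
    (Homeomorph.mulLeft₀ (c : ℝ) hc0.ne').measurableEmbedding
  conv_lhs => rw [hvol]
  rw [Measure.restrict_smul, lintegral_smul_measure, he.restrict_map, he.lintegral_map, hpre,
    ENNReal.ofReal_coe_nnreal, smul_eq_mul]
  congr 1
  refine setLIntegral_congr_fun measurableSet_Icc fun s hs => ?_
  rw [Real.toNNReal_mul hc0.le, Real.toNNReal_coe]

/-- The diffusively rescaled path is the Brownian rescaling of the original path, time-changed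
with the clock of the rescaled intensity. -/
lemma scaledPath_eq_timeChange {d : ℕ} {lam : EuclideanSpace ℝ (Fin d) → ℝ} {w : PathSpace d}
    (hA : IsClock (intensityClock lam w.1)) {n : ℕ} (hn : n ≠ 0) :
    IsClock (intensityClock (fun x => lam (√(n : ℝ) • x)) (brownianScaling n w).1) ∧
    scaledPath lam n w.1 = timeChange (brownianScaling n w).1
      (intensityClock (fun x => lam (√(n : ℝ) • x)) (brownianScaling n w).1) := by
  have hn' : (n : ℝ≥0) ≠ 0 := by exact_mod_cast hn
  have hs : ∀ t, intensityClock lam w.1 (n * t) = (n : ℝ≥0) *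
      intensityClock (fun x => lam (√(n : ℝ) • x)) (brownianScaling n w).1 t := fun t => by
    have := additiveFunctional_scaling (fun x => (ENNReal.ofReal (lam x))⁻¹) w hn' t
    simp only [NNReal.coe_natCast] at this
    exact this
  have hA' := hA.of_scaling hn' hs
  refine ⟨hA', funext fun t => ?_⟩
  obtain ⟨u, hu⟩ := hA'.exists_eq t
  have hu' : intensityClock lam w.1 (n * u) = ((n * t : ℝ≥0) : ℝ≥0∞) := by
    rw [hs, hu, ENNReal.coe_mul]
  rw [hA'.timeChange_eq _ hu, scaledPath, hA.timeChange_eq _ hu']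
  simp [brownianScaling]

/-! ### Octants and the radial limit of the intensity -/

lemma mem_octant_iff {d : ℕ} {α : Fin d → Fin 2} {x : EuclideanSpace ℝ (Fin d)} :
    x ∈ octant α ↔ ∀ i, 0 < (-1 : ℝ) ^ (α i : ℕ) * x i := by
  have hsq : ∀ i, (-1 : ℝ) ^ (α i : ℕ) * (-1) ^ (α i : ℕ) = 1 := fun i => by
    rw [← mul_pow]; simp
  constructor
  · rintro ⟨t, ht, hx⟩ i
    rw [hx i, ← mul_assoc, hsq, one_mul]
    exact ht i
  · intro h
    exact ⟨fun i => (-1) ^ (α i : ℕ) * x i, h, fun i => by rw [← mul_assoc, hsq, one_mul]⟩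

lemma measurableSet_octant {d : ℕ} (α : Fin d → Fin 2) : MeasurableSet (octant α) := by
  have h : octant α = ⋂ i, {x : EuclideanSpace ℝ (Fin d) | 0 < (-1 : ℝ) ^ (α i : ℕ) * x i} := by
    ext x
    simp [mem_octant_iff]
  rw [h]
  exact MeasurableSet.iInter fun i => measurableSet_lt measurable_const (by fun_prop)

lemma octant_disjoint {d : ℕ} {α β : Fin d → Fin 2} {x : EuclideanSpace ℝ (Fin d)}
    (hα : x ∈ octant α) (hβ : x ∈ octant β) : α = β := by
  rw [mem_octant_iff] at hα hβ
  funext i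
  have h1 := hα i
  have h2 := hβ i
  have hcase : ∀ a : Fin 2, a = 0 ∨ a = 1 := by decide
  rcases hcase (α i) with h | h <;> rcases hcase (β i) with h' | h' <;>
    simp only [h, h'] at h1 h2 ⊢ <;> norm_num at h1 h2 <;> linarith

/-- The octants cover `ℝ^d` up to the coordinate hyperplanes. -/
lemma ae_exists_mem_octant {d : ℕ} :
    ∀ᵐ x : EuclideanSpace ℝ (Fin d), ∃ α, x ∈ octant α := by
  have h1 : ∀ᵐ y : Fin d → ℝ, ∀ i, y i ≠ 0 := ae_all_iff.2 fun i =>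
    Measure.ae_eval_ne (fun _ : Fin d => (volume : Measure ℝ)) i 0
  have h2 := (PiLp.volume_preserving_ofLp (Fin d)).quasiMeasurePreserving.ae h1
  filter_upwards [h2] with x hx
  refine ⟨fun i => if 0 < x i then 0 else 1, mem_octant_iff.2 fun i => ?_⟩
  split_ifs with h
  · simpa using h
  · simpa using lt_of_le_of_ne (not_lt.1 h) (hx i)

lemma octantDensity_of_mem {d : ℕ} (lamInf : (Fin d → Fin 2) → ℝ) {α : Fin d → Fin 2}
    {x : EuclideanSpace ℝ (Fin d)} (hx : x ∈ octant α) :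
    octantDensity lamInf x = (lamInf α)⁻¹ := by
  unfold octantDensity
  rw [Finset.sum_eq_single α]
  · rw [Set.indicator_of_mem hx, mul_one]
  · intro β _ hβ
    rw [Set.indicator_of_notMem fun h => hβ (octant_disjoint h hx), mul_zero]
  · simp

lemma measurable_octantDensity {d : ℕ} (lamInf : (Fin d → Fin 2) → ℝ) :
    Measurable (octantDensity lamInf) := by
  unfold octantDensity
  exact Finset.measurable_sum _ fun α _ =>
    (measurable_const.indicator (measurableSet_octant α)).const_mul _

lemma octantDensity_smul {d : ℕ} (lamInf : (Fin d → Fin 2) → ℝ) {c : ℝ} (hc : 0 < c)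
    (x : EuclideanSpace ℝ (Fin d)) : octantDensity lamInf (c • x) = octantDensity lamInf x := by
  unfold octantDensity
  refine Finset.sum_congr rfl fun α _ => ?_
  have : c • x ∈ octant α ↔ x ∈ octant α := by
    rw [mem_octant_iff, mem_octant_iff]
    refine forall_congr' fun i => ?_
    rw [PiLp.smul_apply, smul_eq_mul, mul_left_comm, mul_pos_iff_of_pos_left hc]
  by_cases h : x ∈ octant α
  · rw [Set.indicator_of_mem h, Set.indicator_of_mem (this.2 h)]
  · rw [Set.indicator_of_notMem h, Set.indicator_of_notMem fun h' => h (this.1 h')]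

lemma octantDensity_nonneg {d : ℕ} {lamInf : (Fin d → Fin 2) → ℝ} (hpos : ∀ α, 0 < lamInf α)
    (x : EuclideanSpace ℝ (Fin d)) : 0 ≤ octantDensity lamInf x :=
  Finset.sum_nonneg fun α _ => mul_nonneg (inv_nonneg.2 (hpos α).le)
    (Set.indicator_nonneg (fun _ _ => zero_le_one) x)

lemma octantDensity_le {d : ℕ} {lamInf : (Fin d → Fin 2) → ℝ} (hpos : ∀ α, 0 < lamInf α)
    (x : EuclideanSpace ℝ (Fin d)) : octantDensity lamInf x ≤ ∑ α, (lamInf α)⁻¹ :=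
  Finset.sum_le_sum fun α _ => mul_le_of_le_one_right (inv_nonneg.2 (hpos α).le)
    (Set.indicator_le_self' (fun _ _ => zero_le_one) x)

lemma exists_le_octantDensity {d : ℕ} {lamInf : (Fin d → Fin 2) → ℝ} (hpos : ∀ α, 0 < lamInf α) :
    ∃ c : ℝ≥0, 0 < c ∧ ∀ᵐ x, (c : ℝ) ≤ octantDensity lamInf x := by
  obtain ⟨α₀, -, hα₀⟩ := Finset.exists_min_image Finset.univ (fun α => (lamInf α)⁻¹)
    ⟨fun _ => 0, Finset.mem_univ _⟩
  refine ⟨⟨(lamInf α₀)⁻¹, (inv_pos.2 (hpos α₀)).le⟩, inv_pos.2 (hpos α₀), ?_⟩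
  filter_upwards [ae_exists_mem_octant] with x ⟨α, hα⟩
  rw [octantDensity_of_mem lamInf hα]
  exact hα₀ α (Finset.mem_univ α)

/-- The distance `|1/λ - υ|` between the inverse intensity and its radial limit. -/
noncomputable def radialDefect {d : ℕ} (lam : EuclideanSpace ℝ (Fin d) → ℝ)
    (lamInf : (Fin d → Fin 2) → ℝ) (x : EuclideanSpace ℝ (Fin d)) : ℝ≥0∞ :=
  ENNReal.ofReal |(lam x)⁻¹ - octantDensity lamInf x|

lemma measurable_radialDefect {d : ℕ} {lam : EuclideanSpace ℝ (Fin d) → ℝ} (h : Measurable lam)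
    (lamInf : (Fin d → Fin 2) → ℝ) : Measurable (radialDefect lam lamInf) :=
  ((h.inv.sub (measurable_octantDensity lamInf)).abs).ennreal_ofReal

lemma inv_le_octantDensity_add {d : ℕ} {lam : EuclideanSpace ℝ (Fin d) → ℝ}
    (lam_pos : ∀ x, 0 < lam x) {lamInf : (Fin d → Fin 2) → ℝ} (hpos : ∀ α, 0 < lamInf α)
    (x : EuclideanSpace ℝ (Fin d)) :
    (ENNReal.ofReal (lam x))⁻¹ ≤
      ENNReal.ofReal (octantDensity lamInf x) + radialDefect lam lamInf x := by
  rw [radialDefect, ← ENNReal.ofReal_inv_of_pos (lam_pos x),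
    ← ENNReal.ofReal_add (octantDensity_nonneg hpos x) (abs_nonneg _)]
  exact ENNReal.ofReal_le_ofReal (by linarith [le_abs_self ((lam x)⁻¹ - octantDensity lamInf x)])

lemma octantDensity_le_inv_add {d : ℕ} {lam : EuclideanSpace ℝ (Fin d) → ℝ}
    (lam_pos : ∀ x, 0 < lam x) (lamInf : (Fin d → Fin 2) → ℝ)
    (x : EuclideanSpace ℝ (Fin d)) :
    ENNReal.ofReal (octantDensity lamInf x) ≤
      (ENNReal.ofReal (lam x))⁻¹ + radialDefect lam lamInf x := by
  rw [radialDefect, ← ENNReal.ofReal_inv_of_pos (lam_pos x),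
    ← ENNReal.ofReal_add (inv_nonneg.2 (lam_pos x).le) (abs_nonneg _)]
  exact ENNReal.ofReal_le_ofReal (by linarith [neg_abs_le ((lam x)⁻¹ - octantDensity lamInf x)])

lemma exists_radialDefect_le {d : ℕ} {lam : EuclideanSpace ℝ (Fin d) → ℝ}
    {lamInf : (Fin d → Fin 2) → ℝ} (hpos : ∀ α, 0 < lamInf α)
    (lam_lim : ∀ α, Tendsto lam
      (comap (fun x : EuclideanSpace ℝ (Fin d) => ‖x‖) atTop ⊓ 𝓟 (octant α)) (𝓝 (lamInf α)))
    {ε : ℝ≥0∞} (hε : 0 < ε) :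
    ∃ R : ℝ, 0 < R ∧ ∀ᵐ x : EuclideanSpace ℝ (Fin d), R < ‖x‖ → radialDefect lam lamInf x ≤ ε := by
  obtain ⟨δ, hδ0, hδε⟩ := ENNReal.lt_iff_exists_nnreal_btwn.1 hε
  have hδ : (0 : ℝ) < δ := by exact_mod_cast hδ0
  have h1 : ∀ α, ∀ᶠ R : ℝ in atTop, ∀ x ∈ octant α, R < ‖x‖ → |(lam x)⁻¹ - (lamInf α)⁻¹| ≤ δ := by
    intro α
    have h2 := (lam_lim α).inv₀ (hpos α).ne'
    have h3 := Metric.tendsto_nhds.1 h2 δ hδ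
    rw [eventually_inf_principal, eventually_comap] at h3
    obtain ⟨R, hR⟩ := eventually_atTop.1 h3
    filter_upwards [eventually_ge_atTop R] with R' hR' x hx hxR
    exact (hR ‖x‖ (hR'.trans hxR.le) x rfl hx).le
  obtain ⟨R, hR, hR0⟩ := ((eventually_all.2 h1).and (eventually_gt_atTop 0)).exists
  refine ⟨R, hR0, ?_⟩
  filter_upwards [ae_exists_mem_octant] with x ⟨α, hα⟩ hx
  rw [radialDefect, octantDensity_of_mem lamInf hα]
  refine le_trans ?_ hδε.le
  rw [← ENNReal.ofReal_coe_nnreal]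
  exact ENNReal.ofReal_le_ofReal (hR α x hα hx)

lemma lintegral_radialDefect_ne_top {d : ℕ} (hd : 0 < d) {lam : EuclideanSpace ℝ (Fin d) → ℝ}
    (lam_pos : ∀ x, 0 < lam x)
    {lamInf : (Fin d → Fin 2) → ℝ} (hpos : ∀ α, 0 < lamInf α) {a R : ℝ} (ha : a < d)
    (hint : IntegrableOn (fun x => (lam x)⁻¹ * ‖x‖ ^ (-a)) (Metric.closedBall 0 R) volume) :
    ∫⁻ x in Metric.closedBall 0 R, radialDefect lam lamInf x * ENNReal.ofReal (‖x‖ ^ (-a)) ≠ ∞ := by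
  set C := ∑ α, (lamInf α)⁻¹ with hC
  have h1 : IntegrableOn (fun x : EuclideanSpace ℝ (Fin d) => ‖x‖ ^ (-a))
      (Metric.closedBall 0 R) volume := by
    have h2 : LocallyIntegrable (fun x : EuclideanSpace ℝ (Fin d) => ‖x‖ ^ (-a)) volume := by
      refine locallyIntegrable_of_norm_le_rpow (C := 1) (α := a) (by rw [finrank_euclideanSpace_fin]; exact hd)
        (by simpa using ha) (ae_of_all _ fun x => ?_)
        (measurable_norm.pow_const (-a)).aestronglyMeasurable
      rw [one_mul, Real.norm_of_nonneg (Real.rpow_nonneg (norm_nonneg x) _)]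
    exact h2.integrableOn_isCompact (isCompact_closedBall 0 R)
  have h3 := (hint.add (h1.const_mul C)).lintegral_lt_top
  refine ne_top_of_le_ne_top h3.ne (lintegral_mono fun x => ?_)
  have hr : 0 ≤ ‖x‖ ^ (-a) := Real.rpow_nonneg (norm_nonneg x) _
  rw [radialDefect, ← ENNReal.ofReal_mul (abs_nonneg _)]
  refine ENNReal.ofReal_le_ofReal ?_
  simp only [Pi.add_apply]
  rw [← add_mul]
  refine mul_le_mul_of_nonneg_right ?_ hr
  have h4 := octantDensity_nonneg hpos x
  have h5 := octantDensity_le hpos x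
  have h6 := inv_pos.2 (lam_pos x)
  rw [abs_le]
  constructor <;> linarith

/-- The exponents for which the occupation density and the local integrability of `1/λ` match:
`(2γ, γ)` in the plane and `(d - 2, 0)` in higher dimension. -/
lemma exists_potential_exponents {d : ℕ} (hd : 2 ≤ d) {lam : EuclideanSpace ℝ (Fin d) → ℝ}
    (lam_two : d = 2 → ∃ γ : ℝ, 0 < γ ∧ γ < 1 / 2 ∧ ∀ R : ℝ, 0 < R →
      IntegrableOn (fun x => (lam x)⁻¹ * ‖x‖ ^ (-2 * γ)) (Metric.closedBall 0 R) volume)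
    (lam_gt : 2 < d → ∀ R : ℝ, 0 < R →
      IntegrableOn (fun x => (lam x)⁻¹ * ‖x‖ ^ (2 - (d : ℝ))) (Metric.closedBall 0 R) volume) :
    ∃ a θ C : ℝ, a < d ∧ θ < 1 ∧ 0 ≤ C ∧
      (∀ t : ℝ, 0 ≤ t → ∀ x : EuclideanSpace ℝ (Fin d), x ≠ 0 →
        ∫⁻ s in Set.Icc 0 t, ENNReal.ofReal (heatKernel d s x) ≤
          ENNReal.ofReal (C * t ^ θ * ‖x‖ ^ (-a))) ∧
      ∀ R : ℝ, 0 < R →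
        IntegrableOn (fun x => (lam x)⁻¹ * ‖x‖ ^ (-a)) (Metric.closedBall 0 R) volume := by
  rcases hd.eq_or_lt with h | h
  · subst h
    obtain ⟨γ, hγ, hγ1, hint⟩ := lam_two rfl
    obtain ⟨C, hC, hpot⟩ := lintegral_heatKernel_two hγ (by linarith : γ < 1)
    refine ⟨2 * γ, γ, C, by push_cast; linarith, by linarith, hC, hpot, fun R hR => ?_⟩
    have := hint R hR
    rwa [neg_mul] at this
  · obtain ⟨C, hC, hpot⟩ := lintegral_heatKernel_of_two_lt h
    refine ⟨d - 2, 0, C, by linarith, one_pos, hC, fun t _ x hx => ?_, fun R hR => ?_⟩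
    · rw [Real.rpow_zero, mul_one, neg_sub]
      exact hpot t x hx
    · rw [neg_sub]
      exact lam_gt h R hR

lemma additiveFunctional_le_add {d : ℕ} {f g h : EuclideanSpace ℝ (Fin d) → ℝ≥0∞}
    (hg : Measurable g) (hfg : ∀ x, f x ≤ g x + h x) (w : PathSpace d) (t : ℝ≥0) :
    additiveFunctional f w.1 t ≤ additiveFunctional g w.1 t + additiveFunctional h w.1 t := by
  unfold additiveFunctional
  rw [← lintegral_add_left]
  · exact lintegral_mono fun s => hfg _
  · exact hg.comp (w.2.measurable.comp measurable_real_toNNReal)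

lemma additiveFunctional_mono {E : Type*} (f : E → ℝ≥0∞) (w : ℝ≥0 → E) :
    Monotone (additiveFunctional f w) := fun s t hst =>
  lintegral_mono_set (Set.Icc_subset_Icc_right (by exact_mod_cast hst))

/-- Almost every Wiener path spends zero time in a given null set. -/
lemma IsWienerProcess.ae_ae_of_ae_volume {d : ℕ} {μ : Measure (PathSpace d)} [IsProbabilityMeasure μ]
    (hμ : IsWienerProcess (canonicalProcess d) μ) {p : EuclideanSpace ℝ (Fin d) → Prop}
    (hp : MeasurableSet {x | p x}) (h : ∀ᵐ x, p x) :
    ∀ᵐ w ∂μ, ∀ᵐ s ∂(volume.restrict (Set.Ici (0 : ℝ))), p (w.1 s.toNNReal) := by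
  have hg : Measurable ({x | p x}ᶜ.indicator fun _ => (1 : ℝ≥0∞)) :=
    measurable_const.indicator hp.compl
  have h0 : ∀ n : ℕ, ∀ᵐ w ∂μ,
      additiveFunctional ({x | p x}ᶜ.indicator fun _ => (1 : ℝ≥0∞)) w.1 n = 0 := by
    intro n
    have h1 := hμ.lintegral_additiveFunctional hg n
    have h2 : ∀ s, ∫⁻ x, {x | p x}ᶜ.indicator (fun _ => (1 : ℝ≥0∞)) x *
        ENNReal.ofReal (heatKernel d s x) = 0 := by
      intro s
      rw [lintegral_eq_zero_of_ae_eq_zero]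
      filter_upwards [h] with x hx
      simp [hx]
    simp_rw [h2, lintegral_zero] at h1
    exact (lintegral_eq_zero_iff (measurable_additiveFunctional hg n)).1 h1
  filter_upwards [ae_all_iff.2 h0] with w hw
  have hU : Set.Ici (0 : ℝ) = ⋃ n : ℕ, Set.Icc (0 : ℝ) n := by
    ext s
    simp only [Set.mem_Ici, Set.mem_iUnion, Set.mem_Icc]
    exact ⟨fun hs => (exists_nat_ge s).imp fun n hn => ⟨hs, hn⟩, fun ⟨n, hn⟩ => hn.1⟩
  rw [hU, ae_restrict_iUnion_iff]
  intro n
  have h3 := (lintegral_eq_zero_iff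
    (hg.comp (w.2.measurable.comp measurable_real_toNNReal))).1 (hw n)
  filter_upwards [h3] with s hs
  by_contra hcon
  simp [hcon] at hs

/-- The limit clock is a clock, with speed bounded below. -/
lemma IsWienerProcess.ae_isClock_octantClock {d : ℕ} {μ : Measure (PathSpace d)}
    [IsProbabilityMeasure μ] (hμ : IsWienerProcess (canonicalProcess d) μ)
    {lamInf : (Fin d → Fin 2) → ℝ} (hpos : ∀ α, 0 < lamInf α) {c : ℝ≥0} (hc : 0 < c)
    (hle : ∀ᵐ x, (c : ℝ) ≤ octantDensity lamInf x) :
    ∀ᵐ w ∂μ, IsClock (octantClock lamInf w.1) ∧ ∀ u v, u ≤ v →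
      octantClock lamInf w.1 u + c * ((v - u : ℝ≥0) : ℝ≥0∞) ≤ octantClock lamInf w.1 v := by
  have hm := measurable_octantDensity lamInf
  filter_upwards [hμ.ae_ae_of_ae_volume (measurableSet_le measurable_const hm) hle] with w hw
  set h : ℝ → ℝ≥0∞ := fun s => ENNReal.ofReal (octantDensity lamInf (w.1 s.toNNReal)) with hh
  have hclock : octantClock lamInf w.1 = fun t : ℝ≥0 => ∫⁻ s in Set.Icc (0 : ℝ) t, h s := rfl
  have hspeed : ∀ u v, u ≤ v →
      octantClock lamInf w.1 u + c * ((v - u : ℝ≥0) : ℝ≥0∞) ≤ octantClock lamInf w.1 v := by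
    intro u v huv
    have huv' : (u : ℝ) ≤ v := huv
    simp only [hclock]
    rw [lintegral_Icc_add_Ioc u.2 huv']
    refine add_le_add le_rfl ?_
    have hsub : Set.Ioc (u : ℝ) v ⊆ Set.Ici 0 := fun x hx => u.2.trans hx.1.le
    calc (c : ℝ≥0∞) * ((v - u : ℝ≥0) : ℝ≥0∞) = ∫⁻ s in Set.Ioc (u : ℝ) v, (c : ℝ≥0∞) := by
          rw [setLIntegral_const, Real.volume_Ioc, ← NNReal.coe_sub huv, ENNReal.ofReal_coe_nnreal]
      _ ≤ _ := by
          refine lintegral_mono_ae ?_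
          filter_upwards [ae_mono (Measure.restrict_mono hsub le_rfl) hw] with s hs
          rw [← ENNReal.ofReal_coe_nnreal]
          exact ENNReal.ofReal_le_ofReal hs
  refine ⟨?_, hspeed⟩
  rw [hclock]
  refine isClock_lintegral ?_ (fun s => ENNReal.ofReal_ne_top) ?_ (fun t => ?_) fun K => ?_
  · exact (hm.comp (w.2.measurable.comp measurable_real_toNNReal)).ennreal_ofReal
  · filter_upwards [hw] with s hs
    exact (ENNReal.ofReal_pos.2 (lt_of_lt_of_le (by exact_mod_cast hc) hs)).ne'
  · refine ne_top_of_le_ne_top ?_ (lintegral_mono fun s =>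
      ENNReal.ofReal_le_ofReal (octantDensity_le hpos (w.1 s.toNNReal)))
    rw [setLIntegral_const]
    exact ENNReal.mul_ne_top ENNReal.ofReal_ne_top (by simp)
  · refine ⟨K / c, ?_⟩
    have h1 := hspeed 0 (K / c) bot_le
    refine le_trans ?_ h1
    rw [tsub_zero, ← ENNReal.coe_mul, mul_div_cancel₀ _ hc.ne', ENNReal.coe_natCast]
    exact le_add_self

/-! ### Unboundedness of the clock, measurability, and vanishing of the errors -/

/-- An additive functional dominating a linear clock up to an error of sublinear expectation is
almost surely unbounded. -/
lemma ae_exists_le_of_tendsto_lintegral_div {d : ℕ} {μ : Measure (PathSpace d)}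
    {c : ℝ≥0} (hc : 0 < c) {S D : PathSpace d → ℝ≥0 → ℝ≥0∞} (hD : ∀ t, Measurable fun w => D w t)
    (hlim : Tendsto (fun t : ℝ≥0 => (∫⁻ w, D w t ∂μ) / t) atTop (𝓝 0))
    (hS : ∀ᵐ w ∂μ, ∀ t : ℝ≥0, (c : ℝ≥0∞) * t ≤ S w t + D w t) :
    ∀ᵐ w ∂μ, ∀ K : ℕ, ∃ t, (K : ℝ≥0∞) ≤ S w t := by
  rw [ae_all_iff]
  intro K
  set N := {w | ¬ ∃ t, (K : ℝ≥0∞) ≤ S w t} with hN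
  have hc2 : ((c / 2 : ℝ≥0) : ℝ≥0∞) ≠ 0 := by exact_mod_cast (half_pos hc).ne'
  -- On `N` the error is at least `c t / 2` once `t ≥ 2 K / c`, so Markov's inequality applies.
  have hbound : ∀ᶠ t : ℝ≥0 in atTop, ((c / 2 : ℝ≥0) : ℝ≥0∞) * μ N ≤ (∫⁻ w, D w t ∂μ) / t := by
    filter_upwards [eventually_ge_atTop (2 * K / c), eventually_gt_atTop 0] with t ht ht0
    have htE : (t : ℝ≥0∞) ≠ 0 := by exact_mod_cast ht0.ne'
    have hKt : (K : ℝ≥0∞) ≤ ((c / 2 * t : ℝ≥0) : ℝ≥0∞) := by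
      rw [← ENNReal.coe_natCast, ENNReal.coe_le_coe]
      rw [div_le_iff₀ hc] at ht
      have h1 : 2 * (K : ℝ≥0) ≤ 2 * (c / 2 * t) := by
        calc 2 * (K : ℝ≥0) ≤ t * c := ht
          _ = 2 * (c / 2 * t) := by rw [← mul_assoc, mul_div_cancel₀ _ two_ne_zero, mul_comm]
      exact le_of_mul_le_mul_left h1 two_pos
    have hsub : N ≤ᵐ[μ] {w | ((c / 2 * t : ℝ≥0) : ℝ≥0∞) ≤ D w t} := by
      filter_upwards [hS] with w hw hwN
      have h2 : S w t < K := not_le.1 fun h => hwN ⟨t, h⟩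
      have h3 : (c : ℝ≥0∞) * t = ((c / 2 * t : ℝ≥0) : ℝ≥0∞) + ((c / 2 * t : ℝ≥0) : ℝ≥0∞) := by
        rw [← ENNReal.coe_add, ← ENNReal.coe_mul, ← add_mul, add_halves]
      have h4 := h3 ▸ (hw t).trans (add_le_add (h2.le.trans hKt) le_rfl)
      exact (ENNReal.add_le_add_iff_left ENNReal.coe_ne_top).1 h4
    have h5 := mul_meas_ge_le_lintegral (μ := μ) (hD t) ((c / 2 * t : ℝ≥0) : ℝ≥0∞)
    rw [ENNReal.le_div_iff_mul_le (Or.inl htE) (Or.inl ENNReal.coe_ne_top), mul_right_comm,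
      ← ENNReal.coe_mul]
    exact (mul_le_mul_right (measure_mono_ae hsub) _).trans h5
  have h6 := ge_of_tendsto hlim hbound
  rw [nonpos_iff_eq_zero, mul_eq_zero] at h6
  exact h6.resolve_left hc2

lemma IsWienerProcess.ae_isClock_intensityClock {d : ℕ} {μ : Measure (PathSpace d)}
    [IsProbabilityMeasure μ] (hμ : IsWienerProcess (canonicalProcess d) μ)
    {lam : EuclideanSpace ℝ (Fin d) → ℝ}
    (lam_meas : Measurable lam) (lam_pos : ∀ x, 0 < lam x)
    {lamInf : (Fin d → Fin 2) → ℝ} (hpos : ∀ α, 0 < lamInf α)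
    (hfin : ∀ t : ℝ≥0, ∫⁻ w, additiveFunctional (radialDefect lam lamInf) w.1 t ∂μ ≠ ∞)
    (hlim : Tendsto (fun t : ℝ≥0 =>
      (∫⁻ w, additiveFunctional (radialDefect lam lamInf) w.1 t ∂μ) / t) atTop (𝓝 0)) :
    ∀ᵐ w ∂μ, IsClock (intensityClock lam w.1) := by
  have hgm := measurable_radialDefect lam_meas lamInf
  have hum : Measurable fun x => ENNReal.ofReal (octantDensity lamInf x) :=
    (measurable_octantDensity lamInf).ennreal_ofReal
  have hfm : Measurable fun x => (ENNReal.ofReal (lam x))⁻¹ := lam_meas.ennreal_ofReal.inv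
  obtain ⟨c, hc, hle⟩ := exists_le_octantDensity hpos
  have hν := hμ.ae_isClock_octantClock hpos hc hle
  have hD : ∀ᵐ w ∂μ, ∀ n : ℕ, additiveFunctional (radialDefect lam lamInf) w.1 n < ∞ :=
    ae_all_iff.2 fun n => ae_lt_top (measurable_additiveFunctional hgm n) (hfin n)
  have htop : ∀ᵐ w ∂μ, ∀ K : ℕ, ∃ t, (K : ℝ≥0∞) ≤ intensityClock lam w.1 t := by
    refine ae_exists_le_of_tendsto_lintegral_div hc (S := fun w t => intensityClock lam w.1 t)
      (fun t => measurable_additiveFunctional hgm t) hlim ?_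
    filter_upwards [hν] with w hw t
    have h1 := hw.2 0 t bot_le
    rw [hw.1.zero, zero_add, tsub_zero] at h1
    exact h1.trans
      (additiveFunctional_le_add hfm (octantDensity_le_inv_add lam_pos lamInf) w t)
  filter_upwards [hν, hD, htop] with w hw hDw htopw
  refine isClock_lintegral (h := fun s => (ENNReal.ofReal (lam (w.1 s.toNNReal)))⁻¹)
    (hfm.comp (w.2.measurable.comp measurable_real_toNNReal))
    (fun s => ENNReal.inv_ne_top.2 (ENNReal.ofReal_pos.2 (lam_pos _)).ne')
    (ae_of_all _ fun s => ENNReal.inv_ne_zero.2 ENNReal.ofReal_ne_top) (fun t => ?_) htopw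
  obtain ⟨n, hn⟩ := exists_nat_ge t
  have h1 := additiveFunctional_le_add hum (inv_le_octantDensity_add lam_pos hpos) w t
  refine ne_top_of_le_ne_top (ENNReal.add_ne_top.2 ⟨(hw.1.finite t).ne, ?_⟩) h1
  exact ((additiveFunctional_mono _ w.1 hn).trans_lt (hDw n)).ne

/-- The Borel σ-algebra of `C(K, E)` is generated by the evaluations. -/
lemma measurable_continuousMap_of_eval {Ω K E : Type*} [MeasurableSpace Ω] [TopologicalSpace K]
    [CompactSpace K] [TopologicalSpace.SeparableSpace K] [NormedAddCommGroup E]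
    [SecondCountableTopology C(K, E)] [CompleteSpace E] [SecondCountableTopology E] [MeasurableSpace E]
    [BorelSpace E] {F : Ω → C(K, E)} (hF : ∀ k, Measurable fun ω => F ω k) : Measurable F := by
  obtain ⟨D, hDc, hDd⟩ := TopologicalSpace.exists_countable_dense K
  have : Countable D := hDc.to_subtype
  have hcont : Continuous fun (f : C(K, E)) (q : D) => f q :=
    continuous_pi fun q => continuous_eval_const (q : K)
  have hinj : Function.Injective fun (f : C(K, E)) (q : D) => f q := by
    intro f g hfg
    have h1 : Set.EqOn f g D := fun q hq => congrFun hfg ⟨q, hq⟩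
    exact ContinuousMap.ext (congrFun (Continuous.ext_on hDd f.continuous g.continuous h1))
  exact (hcont.measurableEmbedding hinj).measurable_comp_iff.1
    (measurable_pi_lambda _ fun q => hF q)

lemma aemeasurable_restrictPath {Ω : Type*} [MeasurableSpace Ω] {P : Measure Ω} {d : ℕ}
    {Z : Ω → ℝ≥0 → EuclideanSpace ℝ (Fin d)} (hc : ∀ᵐ ω ∂P, Continuous (Z ω))
    (hm : ∀ t, AEMeasurable (fun ω => Z ω t) P) (T : ℝ≥0) :
    AEMeasurable (fun ω => restrictPath T (Z ω)) P := by
  refine NullMeasurable.aemeasurable ?_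
  refine measurable_continuousMap_of_eval (Ω := NullMeasurableSpace Ω P)
    (F := fun ω => restrictPath T (Z ω)) fun t => ?_
  have h1 : AEMeasurable (fun ω => restrictPath T (Z ω) t) P := by
    refine (hm t).congr ?_
    filter_upwards [hc] with ω hω
    exact (restrictPath_apply hω t).symm
  exact h1.nullMeasurable

lemma aemeasurable_rightInverse {Ω : Type*} [MeasurableSpace Ω] {P : Measure Ω}
    {A : Ω → ℝ≥0 → ℝ≥0∞} (hA : ∀ᵐ ω ∂P, IsClock (A ω)) (hm : ∀ u, Measurable fun ω => A ω u)
    (t : ℝ≥0) : AEMeasurable (fun ω => (rightInverse (A ω) t).toNNReal) P := by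
  refine NullMeasurable.aemeasurable ?_
  refine measurable_of_Iio (δ := NullMeasurableSpace Ω P)
    (f := fun ω => (rightInverse (A ω) t).toNNReal) fun u => ?_
  have h1 : NullMeasurableSet {ω | (t : ℝ≥0∞) < A ω u} P :=
    (measurableSet_lt measurable_const (hm u)).nullMeasurableSet
  refine h1.congr ?_
  filter_upwards [hA] with ω hω
  refine propext ?_
  change (t : ℝ≥0∞) < A ω u ↔ (rightInverse (A ω) t).toNNReal < u
  rw [← hω.strictMono.lt_iff_lt, hω.apply_rightInverse]

lemma aemeasurable_restrictPath_timeChange {d : ℕ} {μ : Measure (PathSpace d)}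
    {A : PathSpace d → ℝ≥0 → ℝ≥0∞} (hA : ∀ᵐ w ∂μ, IsClock (A w))
    (hm : ∀ u, Measurable fun w => A w u) (T : ℝ≥0) :
    AEMeasurable (fun w => restrictPath T (timeChange w.1 (A w))) μ := by
  refine aemeasurable_restrictPath ?_ (fun t => ?_) T
  · filter_upwards [hA] with w hw
    exact hw.continuous_timeChange w.2
  · exact measurable_uncurry_path.comp_aemeasurable
      (aemeasurable_id.prodMk (aemeasurable_rightInverse hA hm t))

/-- Expectations of the rescaled error functionals vanish. -/
lemma IsWienerProcess.tendsto_lintegral_additiveFunctional_sqrt_smul {d : ℕ}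
    {μ : Measure (PathSpace d)}
    [IsProbabilityMeasure μ] (hμ : IsWienerProcess (canonicalProcess d) μ)
    {g : EuclideanSpace ℝ (Fin d) → ℝ≥0∞} (hg : Measurable g)
    (hlim : Tendsto (fun t : ℝ≥0 => (∫⁻ w, additiveFunctional g w.1 t ∂μ) / t) atTop (𝓝 0))
    {M : ℝ≥0} (hM : 0 < M) :
    Tendsto (fun n : ℕ => ∫⁻ w, additiveFunctional (fun x => g (√((n + 1 : ℕ) : ℝ) • x)) w.1 M ∂μ)
      atTop (𝓝 0) := by
  have h1 : ∀ n : ℕ, ∫⁻ w, additiveFunctional (fun x => g (√((n + 1 : ℕ) : ℝ) • x)) w.1 M ∂μ =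
      M * ((∫⁻ w, additiveFunctional g w.1 ((n + 1 : ℕ) * M) ∂μ) /
        (((n + 1 : ℕ) * M : ℝ≥0) : ℝ≥0∞)) := by
    intro n
    have hn : ((n + 1 : ℕ) : ℝ≥0) ≠ 0 := by positivity
    have hgn : Measurable fun x => g (√((n + 1 : ℕ) : ℝ) • x) :=
      hg.comp (measurable_const_smul _)
    have h2 : ∀ w : PathSpace d, additiveFunctional g w.1 ((n + 1 : ℕ) * M) =
        ((n + 1 : ℕ) : ℝ≥0) * additiveFunctional (fun x => g (√((n + 1 : ℕ) : ℝ) • x))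
          (brownianScaling (n + 1 : ℕ) w).1 M := fun w => by
      have := additiveFunctional_scaling g w hn M
      simp only [NNReal.coe_natCast] at this
      exact this
    simp_rw [h2]
    have hmn : Measurable fun w : PathSpace d =>
        additiveFunctional (fun x => g (√((n + 1 : ℕ) : ℝ) • x))
          (brownianScaling ((n + 1 : ℕ) : ℝ≥0) w).1 M :=
      (measurable_additiveFunctional hgn M).comp (measurable_brownianScaling (d := d) ((n + 1 : ℕ) : ℝ≥0))
    rw [lintegral_const_mul _ hmn]
    have h3 := lintegral_map (μ := μ) (measurable_additiveFunctional hgn M)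
      (measurable_brownianScaling (d := d) ((n + 1 : ℕ) : ℝ≥0))
    rw [hμ.map_brownianScaling hn] at h3
    rw [← h3, ENNReal.coe_mul]
    have hn' : (((n + 1 : ℕ) : ℝ≥0) : ℝ≥0∞) ≠ 0 := by exact_mod_cast hn
    have hM' : (M : ℝ≥0∞) ≠ 0 := by exact_mod_cast hM.ne'
    rw [ENNReal.mul_div_mul_left _ _ hn' ENNReal.coe_ne_top,
      ENNReal.mul_div_cancel hM' ENNReal.coe_ne_top]
  simp_rw [h1]
  have h4 : Tendsto (fun n : ℕ => ((n + 1 : ℕ) * M : ℝ≥0)) atTop atTop :=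
    ((tendsto_natCast_atTop_atTop (R := ℝ≥0)).comp (tendsto_add_atTop_nat 1)).atTop_mul_const hM
  simpa using ENNReal.Tendsto.const_mul (hlim.comp h4) (Or.inr (ENNReal.coe_ne_top (r := M)))

lemma exists_subseq_ae_tendsto_zero {Ω : Type*} [MeasurableSpace Ω] {μ : Measure Ω}
    {f : ℕ → Ω → ℝ≥0∞} (hf : ∀ n, Measurable (f n))
    (h : Tendsto (fun n => ∫⁻ ω, f n ω ∂μ) atTop (𝓝 0)) :
    ∃ ns : ℕ → ℕ, StrictMono ns ∧ ∀ᵐ ω ∂μ, Tendsto (fun i => f (ns i) ω) atTop (𝓝 0) := by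
  obtain ⟨ns, hns, hle⟩ := extraction_forall_of_eventually
    (P := fun i n => ∫⁻ ω, f n ω ∂μ ≤ (2⁻¹ : ℝ≥0∞) ^ i) fun i =>
      ENNReal.tendsto_nhds_zero.1 h _ (ENNReal.pow_pos (by simp) i)
  refine ⟨ns, hns, ?_⟩
  have h1 : ∫⁻ ω, ∑' i, f (ns i) ω ∂μ ≠ ∞ := by
    rw [lintegral_tsum fun i => (hf (ns i)).aemeasurable]
    refine ne_top_of_le_ne_top ?_ (ENNReal.tsum_le_tsum hle)
    rw [ENNReal.tsum_geometric]
    simp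
  filter_upwards [ae_lt_top (Measurable.tsum fun i => hf (ns i)) h1] with ω hω
  exact ENNReal.tendsto_atTop_zero_of_tsum_ne_top hω.ne

/-! ### The radial limit theorem -/

/-- The clock of the rescaled intensity is almost surely a clock: by Brownian scaling it runs, up
to a constant factor, like the original clock along another Wiener path. -/
lemma IsWienerProcess.ae_isClock_intensityClock_sqrt_smul {d : ℕ} {μ : Measure (PathSpace d)}
    [IsProbabilityMeasure μ] (hμ : IsWienerProcess (canonicalProcess d) μ)
    {lam : EuclideanSpace ℝ (Fin d) → ℝ} (h : ∀ᵐ w ∂μ, IsClock (intensityClock lam w.1))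
    {n : ℕ} (hn : n ≠ 0) :
    ∀ᵐ w ∂μ, IsClock (intensityClock (fun x => lam (√(n : ℝ) • x)) w.1) := by
  have hn' : (n : ℝ≥0) ≠ 0 := by exact_mod_cast hn
  rw [← hμ.map_brownianScaling (inv_ne_zero hn')] at h
  filter_upwards [ae_of_ae_map (measurable_brownianScaling _).aemeasurable h] with w hw
  have hinv : brownianScaling n (brownianScaling (n : ℝ≥0)⁻¹ w) = w := by
    refine Subtype.ext (funext fun t => ?_)
    have hs : √(n : ℝ) ≠ 0 := (Real.sqrt_pos.2 (by positivity)).ne'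
    simp only [brownianScaling, smul_smul]
    rw [inv_mul_cancel_left₀ hn']
    simp [hs]
  have h1 := (scaledPath_eq_timeChange hw hn).1
  rwa [hinv] at h1

/-- Convergence in distribution only involves the laws. -/
lemma MeasureTheory.TendstoInDistribution.congr_law {ι E Ω₁ Ω₂ Ω₃ Ω₄ : Type*} {l : Filter ι}
    [TopologicalSpace E] [MeasurableSpace E] [OpensMeasurableSpace E]
    [MeasurableSpace Ω₁] {μ₁ : Measure Ω₁} [IsProbabilityMeasure μ₁]
    [MeasurableSpace Ω₂] {μ₂ : Measure Ω₂} [IsProbabilityMeasure μ₂]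
    [MeasurableSpace Ω₃] {μ₃ : Measure Ω₃} [IsProbabilityMeasure μ₃]
    [MeasurableSpace Ω₄] {μ₄ : Measure Ω₄} [IsProbabilityMeasure μ₄]
    {X : ι → Ω₁ → E} {Z : Ω₂ → E} {Y : ι → Ω₃ → E} {V : Ω₄ → E}
    (h : TendstoInDistribution X l Z (fun _ => μ₁) μ₂) (hY : ∀ i, AEMeasurable (Y i) μ₃)
    (hV : AEMeasurable V μ₄) (hYX : ∀ i, μ₃.map (Y i) = μ₁.map (X i)) (hVZ : μ₄.map V = μ₂.map Z) :
    TendstoInDistribution Y l V (fun _ => μ₃) μ₄ := by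
  refine ⟨hY, hV, ?_⟩
  have h1 : (⟨μ₄.map V, Measure.isProbabilityMeasure_map hV⟩ : ProbabilityMeasure E) =
      ⟨μ₂.map Z, Measure.isProbabilityMeasure_map h.aemeasurable_limit⟩ := Subtype.ext hVZ
  exact h1 ▸ h.tendsto.congr fun i => Subtype.ext (hYX i).symm

lemma IsClock.continuous_scaledPath {d : ℕ} {lam : EuclideanSpace ℝ (Fin d) → ℝ} {w : PathSpace d}
    (hA : IsClock (intensityClock lam w.1)) (n : ℕ) : Continuous (scaledPath lam n w.1) := by
  have h : Continuous fun t : ℝ≥0 => (n : ℝ≥0) * t := continuous_const.mul continuous_id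
  exact ((hA.continuous_timeChange w.2).comp h).const_smul (√(n : ℝ))⁻¹

lemma scaledPath_zero {d : ℕ} (lam : EuclideanSpace ℝ (Fin d) → ℝ)
    (w : ℝ≥0 → EuclideanSpace ℝ (Fin d)) : scaledPath lam 0 w = 0 := by
  funext t
  unfold scaledPath
  rw [Nat.cast_zero, Real.sqrt_zero, inv_zero, zero_smul]
  rfl

/-- The radial limit theorem along the paths of one and the same Wiener measure: there the
convergence holds almost surely along suitable subsequences of any sequence. -/
lemma IsWienerProcess.tendstoInDistribution_timeChange {d : ℕ} {μ : Measure (PathSpace d)}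
    [IsProbabilityMeasure μ] (hμ : IsWienerProcess (canonicalProcess d) μ)
    {lam : EuclideanSpace ℝ (Fin d) → ℝ}
    (lam_meas : Measurable lam) (lam_pos : ∀ x, 0 < lam x)
    {lamInf : (Fin d → Fin 2) → ℝ} (hpos : ∀ α, 0 < lamInf α)
    (hlim : Tendsto (fun t : ℝ≥0 =>
      (∫⁻ w, additiveFunctional (radialDefect lam lamInf) w.1 t ∂μ) / t) atTop (𝓝 0))
    (hclock : ∀ᵐ w ∂μ, IsClock (intensityClock lam w.1)) (T : ℝ≥0) :
    TendstoInDistribution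
      (fun (n : ℕ) (w : PathSpace d) => restrictPath T (timeChange w.1
        (intensityClock (fun x => lam (√((n + 1 : ℕ) : ℝ) • x)) w.1)))
      atTop (fun w : PathSpace d => restrictPath T (skewPath lamInf w.1)) (fun _ => μ) μ := by
  obtain ⟨c, hc, hle⟩ := exists_le_octantDensity hpos
  have hν := hμ.ae_isClock_octantClock hpos hc hle
  have hum : Measurable fun x => ENNReal.ofReal (octantDensity lamInf x) :=
    (measurable_octantDensity lamInf).ennreal_ofReal
  have hgm := measurable_radialDefect lam_meas lamInf
  have hfm : ∀ n : ℕ, Measurable fun x => (ENNReal.ofReal (lam (√((n + 1 : ℕ) : ℝ) • x)))⁻¹ :=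
    fun n => (lam_meas.comp (measurable_const_smul _)).ennreal_ofReal.inv
  have hclock' : ∀ᵐ w ∂μ, ∀ n : ℕ,
      IsClock (intensityClock (fun x => lam (√((n + 1 : ℕ) : ℝ) • x)) w.1) :=
    ae_all_iff.2 fun n => hμ.ae_isClock_intensityClock_sqrt_smul hclock n.succ_ne_zero
  have hX : ∀ n : ℕ, AEMeasurable (fun w : PathSpace d => restrictPath T (timeChange w.1
      (intensityClock (fun x => lam (√((n + 1 : ℕ) : ℝ) • x)) w.1))) μ := fun n =>
    aemeasurable_restrictPath_timeChange (hclock'.mono fun w hw => hw n)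
      (fun u => measurable_additiveFunctional (hfm n) u) T
  have hZ : AEMeasurable (fun w : PathSpace d => restrictPath T (skewPath lamInf w.1)) μ :=
    aemeasurable_restrictPath_timeChange (hν.mono fun w hw => hw.1)
      (fun u => measurable_additiveFunctional hum u) T
  -- the limit clock has passed `T` by the deterministic time `M`
  set M : ℝ≥0 := (T + 1) / c with hM
  have hM0 : 0 < M := by positivity
  have hTM : T < c * M := by
    rw [hM, mul_div_cancel₀ _ hc.ne']
    exact lt_add_one T
  refine ⟨hX, hZ, ?_⟩
  refine tendsto_of_subseq_tendsto fun ns hns => ?_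
  have hD := (hμ.tendsto_lintegral_additiveFunctional_sqrt_smul hgm hlim hM0).comp hns
  obtain ⟨ms, hms, hae⟩ := exists_subseq_ae_tendsto_zero (μ := μ)
    (f := fun i (w : PathSpace d) => additiveFunctional
      (fun x => radialDefect lam lamInf (√((ns i + 1 : ℕ) : ℝ) • x)) w.1 M)
    (fun i => measurable_additiveFunctional (hgm.comp (measurable_const_smul _)) M) hD
  refine ⟨ms, (tendstoInDistribution_of_ae_tendsto (μ' := μ) (X := fun i (w : PathSpace d) =>
    restrictPath T (timeChange w.1
      (intensityClock (fun x => lam (√((ns (ms i) + 1 : ℕ) : ℝ) • x)) w.1)))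
    (fun i => hX (ns (ms i))) hZ ?_).tendsto⟩
  filter_upwards [hν, hclock', hae] with w hνw hclw haew
  -- `υ` is invariant under dilations, so the error of the clocks is the rescaled defect
  have hhom : ∀ (n : ℕ) x, octantDensity lamInf (√((n + 1 : ℕ) : ℝ) • x) =
      octantDensity lamInf x := fun n x =>
    octantDensity_smul lamInf (Real.sqrt_pos.2 (by positivity)) x
  refine tendsto_restrictPath_timeChange w.2 (Eventually.of_forall fun i => hclw _) hνw.1 hc
    hνw.2 haew (fun i v hv => ?_) (fun i v hv => ?_) hTM
  · refine (additiveFunctional_le_add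
      (h := fun x => radialDefect lam lamInf (√((ns (ms i) + 1 : ℕ) : ℝ) • x)) hum
      (fun x => ?_) w v).trans (add_le_add le_rfl (additiveFunctional_mono _ _ hv))
    rw [← hhom (ns (ms i)) x]
    exact inv_le_octantDensity_add lam_pos hpos _
  · refine (additiveFunctional_le_add
      (h := fun x => radialDefect lam lamInf (√((ns (ms i) + 1 : ℕ) : ℝ) • x))
      (hfm (ns (ms i))) (fun x => ?_) w v).trans
      (add_le_add le_rfl (additiveFunctional_mono _ _ hv))
    rw [← hhom (ns (ms i)) x]
    exact octantDensity_le_inv_add lam_pos lamInf _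

theorem mainTheorem1 (d : ℕ) (hd : 2 ≤ d)
    (lam : EuclideanSpace ℝ (Fin d) → ℝ)
    (lam_meas : Measurable lam) (lam_pos : ∀ x, 0 < lam x)
    (lam_int : LocallyIntegrable (fun x => (lam x)⁻¹) volume)
    (lamInf : (Fin d → Fin 2) → ℝ) (lamInf_pos : ∀ α, 0 < lamInf α)
    (lam_lim : ∀ α, Tendsto lam
      (comap (fun x : EuclideanSpace ℝ (Fin d) => ‖x‖) atTop ⊓ 𝓟 (octant α)) (𝓝 (lamInf α)))
    (lam_two : d = 2 → ∃ γ : ℝ, 0 < γ ∧ γ < 1 / 2 ∧ ∀ R : ℝ, 0 < R →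
      IntegrableOn (fun x => (lam x)⁻¹ * ‖x‖ ^ (-2 * γ)) (Metric.closedBall 0 R) volume)
    (lam_gt : 2 < d → ∀ R : ℝ, 0 < R →
      IntegrableOn (fun x => (lam x)⁻¹ * ‖x‖ ^ (2 - (d : ℝ))) (Metric.closedBall 0 R) volume)
    {Ω : Type*} [MeasurableSpace Ω] (P : Measure Ω) [IsProbabilityMeasure P]
    (B : ℝ≥0 → Ω → EuclideanSpace ℝ (Fin d)) (hB : IsWienerProcess B P)
    {Ω' : Type*} [MeasurableSpace Ω'] (P' : Measure Ω') [IsProbabilityMeasure P']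
    (W : ℝ≥0 → Ω' → EuclideanSpace ℝ (Fin d)) (hW : IsWienerProcess W P') :
    (∀ᵐ ω ∂P, IsClock (intensityClock lam (B · ω)) ∧
      ∀ n : ℕ, Continuous (scaledPath lam n (B · ω))) ∧
    (∀ᵐ ω ∂P', IsClock (octantClock lamInf (W · ω)) ∧
      Continuous (skewPath lamInf (W · ω))) ∧
    ∀ T : ℝ≥0, TendstoInDistribution
      (fun (n : ℕ) (ω : Ω) => restrictPath T (scaledPath lam n (B · ω)))
      atTop
      (fun ω : Ω' => restrictPath T (skewPath lamInf (W · ω)))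
      (fun _ => P) P' := by
  -- transfer to the common law `P.map b` of both processes on path space
  obtain ⟨b, hb, hbB⟩ := hB.exists_measurable_path
  obtain ⟨b', hb', hbW⟩ := hW.exists_measurable_path
  have hbB' : ∀ᵐ ω ∂P, (B · ω) = (b ω).1 := hbB.mono fun ω h => funext h
  have hbW' : ∀ᵐ ω ∂P', (W · ω) = (b' ω).1 := hbW.mono fun ω h => funext h
  have := Measure.isProbabilityMeasure_map (μ := P) hb.aemeasurable
  have := Measure.isProbabilityMeasure_map (μ := P') hb'.aemeasurable
  have hμ : IsWienerProcess (canonicalProcess d) (P.map b) :=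
    IsWienerProcess.map_path hb (hB.congr hbB)
  have hμ' : IsWienerProcess (canonicalProcess d) (P'.map b') :=
    IsWienerProcess.map_path hb' (hW.congr hbW)
  have hlaw : P'.map b' = P.map b := hμ'.law_unique hμ
  obtain ⟨a, θ, C, ha, hθ, hC, hpot, hint⟩ := exists_potential_exponents hd lam_two lam_gt
  have hd0 : 0 < d := by lia
  obtain ⟨hfin, hlim⟩ := hμ.tendsto_lintegral_additiveFunctional_div hd0 hC hθ hpot
    (measurable_radialDefect lam_meas lamInf)
    (fun R hR => lintegral_radialDefect_ne_top hd0 lam_pos lamInf_pos ha (hint R hR))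
    (fun ε hε => exists_radialDefect_le lamInf_pos lam_lim hε)
  have hclock := hμ.ae_isClock_intensityClock lam_meas lam_pos lamInf_pos hfin hlim
  have hclockB := ae_of_ae_map hb.aemeasurable hclock
  obtain ⟨c, hc, hle⟩ := exists_le_octantDensity lamInf_pos
  have hclockW := ae_of_ae_map hb'.aemeasurable (hμ'.ae_isClock_octantClock lamInf_pos hc hle)
  refine ⟨?_, ?_, fun T => ?_⟩
  · filter_upwards [hbB', hclockB] with ω hω hA
    rw [hω]
    exact ⟨hA, fun n => hA.continuous_scaledPath n⟩
  · filter_upwards [hbW', hclockW] with ω hω hA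
    rw [hω]
    exact ⟨hA.1, hA.1.continuous_timeChange (b' ω).2⟩
  have hT := hμ.tendstoInDistribution_timeChange lam_meas lam_pos lamInf_pos hlim hclock T
  have hσ : ∀ n : ℕ, (P.map b).map (brownianScaling (n + 1 : ℕ)) = P.map b := fun n =>
    hμ.map_brownianScaling (by positivity)
  have hcongr : ∀ n : ℕ, (fun ω => restrictPath T (timeChange
      (brownianScaling (n + 1 : ℕ) (b ω)).1 (intensityClock
        (fun x => lam (√((n + 1 : ℕ) : ℝ) • x)) (brownianScaling (n + 1 : ℕ) (b ω)).1))) =ᵐ[P]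
      fun ω => restrictPath T (scaledPath lam (n + 1) (B · ω)) := by
    intro n
    filter_upwards [hbB', hclockB] with ω hω hA
    rw [hω, (scaledPath_eq_timeChange hA n.succ_ne_zero).2]
  have hXσ : ∀ n : ℕ, AEMeasurable (fun w : PathSpace d => restrictPath T (timeChange
      (brownianScaling (n + 1 : ℕ) w).1 (intensityClock
        (fun x => lam (√((n + 1 : ℕ) : ℝ) • x)) (brownianScaling (n + 1 : ℕ) w).1)))
      (P.map b) := fun n =>
    ((hσ n).symm ▸ hT.forall_aemeasurable n).comp_measurable (measurable_brownianScaling _)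
  have hZcongr : (fun ω => restrictPath T (skewPath lamInf (b' ω).1)) =ᵐ[P']
      fun ω => restrictPath T (skewPath lamInf (W · ω)) := by
    filter_upwards [hbW'] with ω hω
    rw [hω]
  have hZ' : AEMeasurable (fun w : PathSpace d => restrictPath T (skewPath lamInf w.1))
      (P'.map b') := hlaw ▸ hT.aemeasurable_limit
  have hXB : ∀ n : ℕ, AEMeasurable (fun ω => restrictPath T (scaledPath lam n (B · ω))) P := by
    intro n
    cases n with
    | zero => simp only [scaledPath_zero]; exact aemeasurable_const
    | succ n => exact ((hXσ n).comp_measurable hb).congr (hcongr n)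
  refine ⟨hXB, (hZ'.comp_measurable hb').congr hZcongr, ?_⟩
  refine (tendsto_add_atTop_iff_nat 1).1 ?_
  refine (hT.congr_law (fun n => hXB (n + 1)) ((hZ'.comp_measurable hb').congr hZcongr)
    (fun n => ?_) ?_).tendsto
  · rw [← Measure.map_congr (hcongr n)]
    conv_rhs => rw [← hσ n]
    rw [AEMeasurable.map_map_of_aemeasurable ((hσ n).symm ▸ hT.forall_aemeasurable n)
      (measurable_brownianScaling _).aemeasurable]
    exact (AEMeasurable.map_map_of_aemeasurable (hXσ n) hb.aemeasurable).symm
  · rw [← Measure.map_congr hZcongr, ← hlaw]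
    exact (AEMeasurable.map_map_of_aemeasurable hZ' hb'.aemeasurable).symm
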